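/- Let $r\geq 0$, $W=S_r$ with simple reflections $s_i=(i,i+1)$ and length $\ell$. Let $R$ be an integral domain and $t\in R^\times$ (for instance $R=\mathbb{C}$, or $R=\mathbb{C}[t,t^{-1}]$ with $t$ an indeterminate). Let $\mathbf{z}=(z_1,\dots,z_r)$ be indeterminates, $\mathbf{z}^{\alpha_i}=z_i/z_{i+1}$, let $s_i$ act on functions of $\mathbf{z}$ by exchanging $z_i$ and $z_{i+1}$, and put $$\mathcal{L}_{i,t}f=\frac{f-s_if}{\mathbf{z}^{\alpha_i}-1}-t\,\frac{f-\mathbf{z}^{\alpha_i}s_if}{\mathbf{z}^{\alpha_i}-1},\qquad \mathcal{L}_{i,t}^{-1}f=\frac{f-s_if}{\mathbf{z}^{-\alpha_i}-1}-t^{-1}\,\frac{f-\mathbf{z}^{-\alpha_i}s_if}{\mathbf{z}^{-\alpha_i}-1},$$ and $\mathcal{L}_{w,t}=\mathcal{L}_{i_1,t}\cdots\mathcal{L}_{i_k,t}$ for any reduced expression $w=s_{i_1}\cdots s_{i_k}$. Let $\lambda=(\lambda_1\geq\dots\geq\lambda_r)\in\mathbb{Z}^r$ and let $M\leq N$ be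 integers with $M\leq\lambda_i\leq N$ for all $i$ (for a partition one may take $M=0$). Let $\gamma_1>\dots>\gamma_r$ be colors. For a permutation $w$ let $w\mathbf{c}_0$ be the flag whose $i$-th color is $\gamma_{w^{-1}(i)}$; these are the proper flags, i.e. the sequences of $r$ distinct colors. For proper flags $\mathbf{c},\mathbf{d}$ consider a grid with rows $1,\dots,r$ from top to bottom and columns labeled $N,N-1,\dots,M$ from left to right. Horizontal edges carry spins in $\{+,\gamma_1,\dots,\gamma_r\}$, vertical edges carry multisets of colors. The boundary spins are $+$ on the left, $d_i$ on the right of row $i$, the empty multiset at the bottom, and at the top of column $j$ the multiset in which $\gamma_k$ has multiplicity $\#\{i:\lambda_i=j,\ c_i=\gamma_k\}$. A vertex in row $i$ is the fusion of $r$ monochrome vertices of colors $\gamma_r,\dots,\gamma_1$ from left to right: its weight is the sum, over the spins of the $r-1$ intermediate horizontal edges, of the product of the monochrome weights, the $k$-th multiplicity of the top and bottom spin being attached to the vertex of color $\gamma_k$. The weight of the monochrome vertex of color $c$ in row $i$, with spins (left, top, right, bottom), is $$(+,n,+,n)\mapsto 1;\qquad (d,n,d,n)\mapsto 1,\ z_i,\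 t^n\ \text{ for } c<d,\ c=d,\ c>d \text{ respectively};$$ $$(c,n,+,n+1)\mapsto z_i(1-t^{n+1});\qquad (+,n+1,c,n)\mapsto 1$$ for the $P$-weights; for the $R$-weights the last two are replaced by $z_i(1-t)$ and $1+t+\dots+t^n$; all other weights are $0$. The weight of a state (an assignment of spins to all edges with the given boundary spins) is the product of the weights of its vertices, and $$Z(\mathfrak{S}_{\lambda,\mathbf{c},\mathbf{d}}(\mathbf{z};t))=(z_1\cdots z_r)^M\sum_{\text{states}}(\text{weight of the state}).$$ Theorem. For both the $P$- and the $R$-weights, for every admissible choice of $M,N$ and for all $w,y\in W$, only finitely many states have nonzero weight, and: (1) $Z(\mathfrak{S}_{\lambda,\mathbf{c}_0,w\mathbf{c}_0}(\mathbf{z};t))=\mathcal{L}_{w,t}\,\mathbf{z}^\lambda$, where $w$ has a reduced expression and any one of them may be used to compute $\mathcal{L}_{w,t}\,\mathbf{z}^\lambda$; (2) more generally, $Z(\mathfrak{S}_{\lambda,y\mathbf{c}_0,w\mathbf{c}_0}(\mathbf{z};t))=\tau^\lambda_{w,y}(\mathbf{z};t)$, where, for fixed $y$, $(\tau^\lambda_{w,y})_{w\in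 W}$ is the unique family in $R[z_1^{\pm1},\dots,z_r^{\pm1}]$ such that $\tau^\lambda_{y,y}=t^{\ell(y)}\mathbf{z}^\lambda$ and, for every $w$ and every simple reflection $s_i$, $\tau^\lambda_{s_iw,y}=\mathcal{L}_{i,t}\tau^\lambda_{w,y}$ if $s_iw>w$ and $\tau^\lambda_{s_iw,y}=\mathcal{L}_{i,t}^{-1}\tau^\lambda_{w,y}$ if $s_iw<w$. -/

import Mathlib

open scoped BigOperators

namespace ColoredBoson

/-! ### The symmetric group `W = S_r`, acting on `{0, …, r-1}` -/

/-- The index `i` of the simple reflection `s_i`, as an element of `Fin r`. -/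
def lo {r : ℕ} (i : Fin (r - 1)) : Fin r := ⟨i.1, by omega⟩

/-- The index `i + 1`, as an element of `Fin r`. -/
def hi {r : ℕ} (i : Fin (r - 1)) : Fin r := ⟨i.1 + 1, by omega⟩

/-- The simple reflection `s_i = (i, i+1)`. -/
def simpleRefl {r : ℕ} (i : Fin (r - 1)) : Equiv.Perm (Fin r) := Equiv.swap (lo i) (hi i)

/-- The length `ℓ(w)`: the number of inversions of `w`, that is, the number of positive roots
that `w` makes negative. -/
def len {r : ℕ} (w : Equiv.Perm (Fin r)) : ℕ :=
  (Finset.univ.filter fun p : Fin r × Fin r => p.1 < p.2 ∧ w p.2 < w p.1).card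

/-- `l = [i_1, …, i_k]` is a reduced word of `w`, i.e. `w = s_{i_1} ⋯ s_{i_k}` with `k = ℓ(w)`. -/
def IsReducedWord {r : ℕ} (w : Equiv.Perm (Fin r)) (l : List (Fin (r - 1))) : Prop :=
  (l.map simpleRefl).prod = w ∧ l.length = len w

/-! ### Laurent polynomials in `z_1, …, z_r` and Demazure-Lusztig operators

The base ring `R` is a domain. The parameter `t` is a unit of `R`: the case `R = ℂ` is that of a
nonzero complex parameter, and `R = ℂ[t, t⁻¹]` that of an indeterminate. Everything takes place in
the field of fractions of `R[z_1, …, z_r]`, which contains the ring `R[z_1^±, …, z_r^±]`. -/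

section Operators

variable (R : Type*) [CommRing R] [IsDomain R] (r : ℕ)

/-- The field of rational functions in `z_1, …, z_r`. -/
abbrev RatField : Type _ := FractionRing (MvPolynomial (Fin r) R)

variable {r}

/-- The variable `z_i`. -/
noncomputable def zvar (i : Fin r) : RatField R r :=
  algebraMap (MvPolynomial (Fin r) R) (RatField R r) (MvPolynomial.X i)

/-- The monomial `z^μ = ∏ z_i ^ μ_i`. -/
noncomputable def zmon (μ : Fin r → ℤ) : RatField R r := ∏ i, zvar R i ^ μ i

variable (r) in
/-- The ring `R[z_1^±, …, z_r^±]` of Laurent polynomials. -/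
noncomputable def laurent : Subalgebra R (RatField R r) :=
  Algebra.adjoin R (Set.range (zvar R) ∪ Set.range fun i : Fin r => (zvar R i)⁻¹)

/-- The substitution `z_j ↦ z_{σ(j)}`. -/
noncomputable def permVars (σ : Equiv.Perm (Fin r)) : RatField R r ≃+* RatField R r :=
  IsFractionRing.ringEquivOfRingEquiv (MvPolynomial.renameEquiv R σ).toRingEquiv

/-- `z^{α_i} = z_i / z_{i+1}`. -/
noncomputable def zroot (i : Fin (r - 1)) : RatField R r := zvar R (lo i) / zvar R (hi i)

variable {R}

/-- The parameter `t` as an element of the field of rational functions. -/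
noncomputable def param (r : ℕ) (t : Rˣ) : RatField R r := algebraMap R (RatField R r) t

/-- The Demazure-Lusztig operator `𝓛_{i,t}`. -/
noncomputable def demLus (t : Rˣ) (i : Fin (r - 1)) (f : RatField R r) : RatField R r :=
  (f - permVars R (simpleRefl i) f) / (zroot R i - 1)
    - param r t * ((f - zroot R i * permVars R (simpleRefl i) f) / (zroot R i - 1))

/-- The inverse operator `𝓛_{i,t}⁻¹`. -/
noncomputable def demLusInv (t : Rˣ) (i : Fin (r - 1)) (f : RatField R r) : RatField R r :=
  (f - permVars R (simpleRefl i) f) / ((zroot R i)⁻¹ - 1)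
    - (param r t)⁻¹ *
      ((f - (zroot R i)⁻¹ * permVars R (simpleRefl i) f) / ((zroot R i)⁻¹ - 1))

/-- `𝓛_{i_1,t} ⋯ 𝓛_{i_k,t}` for a word `[i_1, …, i_k]`; it is `𝓛_{w,t}` if the word is a reduced
word of `w`. -/
noncomputable def demLusWord (t : Rˣ) : List (Fin (r - 1)) → RatField R r → RatField R r
  | [], f => f
  | i :: l, f => demLus t i (demLusWord t l f)

/-- The conditions that characterize the family `(τ^μ_{w,y})_{w ∈ W}` for given `μ` and `y`. For a
simple reflection `s`, the relation `s w > w` of the Bruhat order means `ℓ(s w) > ℓ(w)`. -/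
structure IsTauFamily (t : Rˣ) (μ : Fin r → ℤ) (y : Equiv.Perm (Fin r))
    (τ : Equiv.Perm (Fin r) → RatField R r) : Prop where
  mem_laurent : ∀ w, τ w ∈ laurent R r
  base : τ y = param r t ^ len y * zmon R μ
  up : ∀ (i : Fin (r - 1)) (w : Equiv.Perm (Fin r)), len w < len (simpleRefl i * w) →
    τ (simpleRefl i * w) = demLus t i (τ w)
  down : ∀ (i : Fin (r - 1)) (w : Equiv.Perm (Fin r)), len (simpleRefl i * w) < len w →
    τ (simpleRefl i * w) = demLusInv t i (τ w)

end Operators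

/-! ### The colored bosonic models

The color `γ_{k+1}` is represented by `k : Fin r`. Since `γ_1 > ⋯ > γ_r`, a smaller index means a
larger color. Horizontal spins are elements of `Option (Fin r)`, with `none` for the vacuum color
`+`; vertical spins are multisets of colors, given by their multiplicities `Fin r → ℕ`. -/

/-- The two variants of the Boltzmann weights. -/
inductive WeightKind
  | P
  | R

section Model

variable {A : Type*} [CommRing A] {r : ℕ}

/-- Boltzmann weight of the monochrome vertex of type `(z, c)` with left spin `a`, top spin `n`,
right spin `b` and bottom spin `m`. The four nonzero cases are `A(n)`, `B(n)`, `C(n)`, `D(m)`;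
the weight `(1 - t^{m+1}) / (1 - t)` is written as `1 + t + ⋯ + t^m`. -/
def monoWeight (κ : WeightKind) (t z : A) (c : Fin r) (a : Option (Fin r)) (n : ℕ)
    (b : Option (Fin r)) (m : ℕ) : A :=
  match a, b with
  | none, none => if m = n then 1 else 0
  | some d, some e =>
      if d = e ∧ m = n then
        if d < c then 1 else if c = d then z else t ^ n
      else 0
  | some d, none =>
      if d = c ∧ m = n + 1 then
        match κ with
        | .P => z * (1 - t ^ (n + 1))
        | .R => z * (1 - t)
      else 0
  | none, some e =>
      if e = c ∧ n = m + 1 then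
        match κ with
        | .P => 1
        | .R => ∑ k ∈ Finset.range (m + 1), t ^ k
      else 0

/-- Boltzmann weight of the fused vertex with left, top, right and bottom spins `a, b, c, d`: the
partition function of a row of `r` monochrome vertices of colors `γ_r, …, γ_1` from left to right,
summed over the spins `g` of the horizontal edges with both ends fixed. -/
def fusedWeight (κ : WeightKind) (t z : A) (a : Option (Fin r)) (b : Fin r → ℕ)
    (c : Option (Fin r)) (d : Fin r → ℕ) : A :=
  ∑ g : Fin (r + 1) → Option (Fin r),
    if g 0 = a ∧ g (Fin.last r) = c then
      ∏ k : Fin r, monoWeight κ t z k.rev (g k.castSucc) (b k.rev) (g k.succ) (d k.rev)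
    else 0

/-- The top boundary spin in the column labeled `j`: the multiplicity of the color `γ_k` is the
number of `i` with `μ_i = j` and `c_i = γ_k`. -/
def topSpin (μ : Fin r → ℤ) (c : Fin r → Fin r) (j : ℤ) : Fin r → ℕ :=
  fun k => (Finset.univ.filter fun i : Fin r => μ i = j ∧ c i = k).card

/-- States of the system with weight `μ`, flags `c, d` and `n` columns labeled `M + n - 1, …, M`
from left to right, so that the column in position `p = 0, …, n - 1` has label `M + (n - 1 - p)`.
There are `r` rows, numbered from top to bottom. `hor i p` is the spin of the horizontal edge of
row `i` to the left of the column in position `p` (to the right of the last column if `p = n`);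
`ver i p` is the spin of the vertical edge in position `p` above row `i` (below the last row if
`i = r`). -/
@[ext]
structure State (μ : Fin r → ℤ) (c d : Fin r → Fin r) (M : ℤ) (n : ℕ) where
  hor : Fin r → Fin (n + 1) → Option (Fin r)
  ver : Fin (r + 1) → Fin n → Fin r → ℕ
  hor_left : ∀ i, hor i 0 = none
  hor_right : ∀ i, hor i (Fin.last n) = some (d i)
  ver_top : ∀ p, ver 0 p = topSpin μ c (M + (p.rev : ℤ))
  ver_bottom : ∀ p, ver (Fin.last r) p = 0

/-- The Boltzmann weight of a state: the product of the weights of all vertices, where the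
vertices in row `i` have spectral parameter `z i`. -/
def State.weight {μ : Fin r → ℤ} {c d : Fin r → Fin r} {M : ℤ} {n : ℕ} (κ : WeightKind) (t : A)
    (z : Fin r → A) (s : State μ c d M n) : A :=
  ∏ i : Fin r, ∏ p : Fin n,
    fusedWeight κ t (z i) (s.hor i p.castSucc) (s.ver i.castSucc p) (s.hor i p.succ)
      (s.ver i.succ p)

/-- The flag `w 𝐜₀`, whose `i`-th color is `γ_{w⁻¹(i)}`; here `𝐜₀ = (γ_1, …, γ_r)`. -/
def flag (w : Equiv.Perm (Fin r)) : Fin r → Fin r := fun i => w⁻¹ i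

end Model

/-- The partition function `Z` of the system: the sum of the Boltzmann weights of its states,
multiplied by `(z_1 ⋯ z_r)^M` for the smallest column label `M` (a factor `1` if the columns are
labeled from `0`, as for partitions). -/
noncomputable def partitionFunction {R : Type*} [CommRing R] [IsDomain R] {r : ℕ}
    (κ : WeightKind) (t : Rˣ) (μ : Fin r → ℤ) (c d : Fin r → Fin r) (M : ℤ) (n : ℕ) :
    RatField R r :=
  (∏ i : Fin r, zvar R i) ^ M *
    ∑ᶠ s : State μ c d M n, s.weight κ (param r t) (zvar R)

end ColoredBoson

/-!
Let `T_d(z)` be the transfer operator of a row with spectral parameter `z`, left spin `+` and right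
spin `d`. The partition function is a matrix coefficient of the product of these operators over the
rows. For two colors `a` and `b` with `a` larger they satisfy an exchange relation

`(z₁ - z₂) T_b(z₁) T_a(z₂) = (1 - t) z₂ T_a(z₁) T_b(z₂) + (t z₁ - z₂) T_a(z₂) T_b(z₁)`,

and applying it to the rows `i` and `i + 1` is the recursion given by `𝓛_{i,t}`. Instead of an
`R`-matrix, the relation is obtained from a system of linear relations between the partition
functions of two rows with parameters `z₁, z₂` and with parameters `z₂, z₁`. The system holds at the
left boundary and is carried to the right through one monochrome vertex of both rows at a time; what
changes at a vertex of color `c` is only which pairs of colors are separated by `c`.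

If the flags at the top and on the right agree, each row has to absorb the leftmost of the remaining
particles, so a single state contributes and it gives `t ^ ℓ(y) z^μ`. All other cases follow by the
recursion.
-/

namespace ColoredBoson

open scoped Matrix Kronecker

/-! ### Sums over paths -/

section PathSum

variable {K : Type*} [CommRing K] {S : Type*} [Fintype S] [DecidableEq S] {N : ℕ}

/-- The transfer matrix of a row of `N` vertices with step matrices `f 0, …, f (N - 1)`: its entry
at `(a, b)` is the sum over the spins of the `N + 1` horizontal edges, with outer spins `a` and `b`,
of the product of the weights. -/
def pathSum (f : Fin N → Matrix S S K) : Matrix S S K :=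
  .of fun a b => ∑ g : Fin (N + 1) → S,
    if g 0 = a ∧ g (Fin.last N) = b then ∏ k : Fin N, f k (g k.castSucc) (g k.succ) else 0

theorem pathSum_zero (f : Fin 0 → Matrix S S K) : pathSum f = 1 := by
  ext a b
  simp only [pathSum, Matrix.of_apply, Matrix.one_apply, Finset.univ_eq_empty, Finset.prod_empty]
  rw [← (Equiv.funUnique (Fin 1) S).symm.sum_comp]
  rcases eq_or_ne a b with rfl | h
  · simp
  · have not_both (x : S) : ¬ (x = a ∧ x = b) := fun hx => h (hx.1.symm.trans hx.2)
    simp [h, not_both]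

theorem pathSum_succ (f : Fin (N + 1) → Matrix S S K) :
    pathSum f = pathSum (fun k => f k.castSucc) * f (Fin.last N) := by
  ext a b
  simp only [pathSum, Matrix.mul_apply, Matrix.of_apply]
  rw [← (Fin.snocEquiv fun _ : Fin (N + 2) => S).sum_comp, Fintype.sum_prod_type]
  simp only [Finset.sum_mul]
  rw [Finset.sum_comm, Finset.sum_comm (s := (Finset.univ : Finset S))]
  refine Finset.sum_congr rfl fun g _ => ?_
  have snoc_zero (y : S) : (Fin.snoc g y : Fin (N + 2) → S) 0 = g 0 := by
    rw [← Fin.castSucc_zero, Fin.snoc_castSucc (α := fun _ => S)]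
  have snoc_succ (y : S) (k : Fin N) :
      (Fin.snoc g y : Fin (N + 2) → S) k.castSucc.succ = g k.succ := by
    rw [Fin.succ_castSucc, Fin.snoc_castSucc (α := fun _ => S)]
  simp only [Fin.snocEquiv_apply, Fin.prod_univ_castSucc, snoc_zero, snoc_succ, Fin.succ_last,
    Fin.snoc_castSucc (α := fun _ => S), Fin.snoc_last (α := fun _ => S)]
  by_cases h : g 0 = a <;> simp [h]

theorem vecMul_pathSum_induction₂ {f f' : Fin N → Matrix S S K}
    {P : Fin (N + 1) → (S → K) → (S → K) → Prop}
    (step : ∀ k φ φ', P k.castSucc φ φ' → P k.succ (φ ᵥ* f k) (φ' ᵥ* f' k))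
    {φ φ' : S → K} (start : P 0 φ φ') :
    P (Fin.last N) (φ ᵥ* pathSum f) (φ' ᵥ* pathSum f') := by
  induction N with
  | zero =>
    rw [pathSum_zero, pathSum_zero, Matrix.vecMul_one, Matrix.vecMul_one]
    exact start
  | succ N ih =>
    simp only [pathSum_succ, ← Matrix.vecMul_vecMul]
    exact step (Fin.last N) _ _
      (ih (P := fun k => P k.castSucc) (fun k _ _ h => step k.castSucc _ _ h) start)

theorem vecMul_pathSum_of_step {f : Fin N → Matrix S S K} {φ : Fin (N + 1) → S → K}
    (step : ∀ k, φ k.castSucc ᵥ* f k = φ k.succ) : φ 0 ᵥ* pathSum f = φ (Fin.last N) := by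
  refine vecMul_pathSum_induction₂ (f' := f) (P := fun k ψ _ => ψ = φ k) (φ' := φ 0) ?_ rfl
  rintro k ψ - rfl
  exact step k

theorem pathSum_eq_zero {f : Fin N → Matrix S S K} {k : Fin N} (h : f k = 0) : pathSum f = 0 := by
  ext a b
  refine Finset.sum_eq_zero fun g _ => ?_
  rw [Finset.prod_eq_zero (Finset.mem_univ k) (by rw [h, Matrix.zero_apply]), ite_self]

theorem pathSum_apply_of_row {f : Fin N → Matrix S S K} {w : Fin N → K} {a : S}
    (row : ∀ k x, f k a x = if x = a then w k else 0) (x : S) :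
    pathSum f a x = if x = a then ∏ k, w k else 0 := by
  induction N generalizing x with
  | zero => simp [pathSum_zero, Matrix.one_apply, eq_comm]
  | succ N ih =>
    simp [pathSum_succ, Matrix.mul_apply, ih fun k => row k.castSucc, row, Fin.prod_univ_castSucc]

theorem pathSum_apply_of_col {f : Fin N → Matrix S S K} {w : Fin N → K} {b : S}
    (col : ∀ k x, f k x b = if x = b then w k else 0) (x : S) :
    pathSum f x b = if x = b then ∏ k, w k else 0 := by
  induction N generalizing x with
  | zero => simp [pathSum_zero, Matrix.one_apply]
  | succ N ih =>
    simp [pathSum_succ, Matrix.mul_apply, ih fun k => col k.castSucc, col, Fin.prod_univ_castSucc]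

theorem pathSum_apply_of_jump {f : Fin N → Matrix S S K} {w : Fin N → K} {a b : S} (p : Fin N)
    (row : ∀ k < p, ∀ x, f k a x = if x = a then w k else 0) (jump : f p a b = w p)
    (col : ∀ k > p, ∀ x, f k x b = if x = b then w k else 0) : pathSum f a b = ∏ k, w k := by
  induction N with
  | zero => exact p.elim0
  | succ N ih =>
    simp only [pathSum_succ, Matrix.mul_apply, Fin.prod_univ_castSucc]
    induction p using Fin.lastCases with
    | last =>
      simp [pathSum_apply_of_row fun k => row k.castSucc k.castSucc_lt_last, jump]
    | cast p =>
      simp [col (Fin.last N) p.castSucc_lt_last, ih p (fun k hk => row k.castSucc hk) jump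
        fun k hk => col k.castSucc hk]

theorem sum_pathSum_kronecker_pathSum {ι V : Type*} [Fintype ι] [DecidableEq ι]
    (e : Fin N ≃ ι) (D : ι → Finset V) (f f' : ι → V → Matrix S S K) :
    ∑ v ∈ Fintype.piFinset D,
        pathSum (fun k => f (e k) (v (e k))) ⊗ₖ pathSum (fun k => f' (e k) (v (e k))) =
      pathSum fun k => ∑ v ∈ D (e k), f (e k) v ⊗ₖ f' (e k) v := by
  ext ⟨a, a'⟩ ⟨b, b'⟩
  simp only [Matrix.sum_apply, Matrix.kroneckerMap_apply, pathSum, Matrix.of_apply,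
    Finset.sum_mul_sum]
  rw [← (Equiv.arrowProdEquivProdArrow (Fin (N + 1)) (fun _ => S) (fun _ => S)).symm.sum_comp,
    Fintype.sum_prod_type, Finset.sum_comm]
  refine Finset.sum_congr rfl fun g _ => ?_
  rw [Finset.sum_comm]
  refine Finset.sum_congr rfl fun g' _ => ?_
  simp only [Equiv.arrowProdEquivProdArrow, Equiv.coe_fn_symm_mk, Prod.mk.injEq]
  have prod_sum : ∏ k, ∑ v ∈ D (e k),
        f (e k) v (g k.castSucc) (g k.succ) * f' (e k) v (g' k.castSucc) (g' k.succ) =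
      ∑ v ∈ Fintype.piFinset D, (∏ k, f (e k) (v (e k)) (g k.castSucc) (g k.succ)) *
        ∏ k, f' (e k) (v (e k)) (g' k.castSucc) (g' k.succ) := by
    simp only [← Finset.prod_mul_distrib]
    rw [← e.symm.prod_comp]
    simp only [Equiv.apply_symm_apply, Finset.prod_univ_sum]
    refine Finset.sum_congr rfl fun v _ => ?_
    rw [← e.prod_comp]
    simp only [Equiv.symm_apply_apply]
  rw [prod_sum]
  simp only [and_and_and_comm, ite_and]
  split_ifs <;> simp only [mul_zero, zero_mul, Finset.sum_const_zero]

end PathSum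

/-! ### Monochrome vertices -/

section MonochromeVertex

variable {K : Type*} [CommRing K] {r : ℕ}

/-- The weight of a monochrome vertex emitting a particle downwards, without its factor `z`; there
are `n` particles above the vertex. -/
def emit (κ : WeightKind) (t : K) (n : ℕ) : K :=
  match κ with
  | .P => 1 - t ^ (n + 1)
  | .R => 1 - t

/-- The weight of a monochrome vertex absorbing a particle from above; there are `n` particles below
the vertex. -/
def absorb (κ : WeightKind) (t : K) (n : ℕ) : K :=
  match κ with
  | .P => 1
  | .R => ∑ k ∈ Finset.range (n + 1), t ^ k

/-- The weight with which a particle of color `d` passes a monochrome vertex of another color `c`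
with `n` particles above it. -/
def pass (t : K) (c d : Fin r) (n : ℕ) : K := if d < c then 1 else t ^ n

/-- The indicator of `m = n` as a ring element. Written as a coefficient, it turns the case
distinctions in the monochrome weights into ring identities. -/
def delta (m n : ℕ) : K := if m = n then 1 else 0

theorem delta_comm (m n : ℕ) : (delta m n : K) = delta n m := by
  simp only [delta, eq_comm]

theorem delta_zero_succ (n : ℕ) : (delta 0 (n + 1) : K) = 0 := rfl

theorem delta_succ_succ (m n : ℕ) : (delta (m + 1) (n + 1) : K) = delta m n := by
  simp only [delta, Nat.add_right_cancel_iff]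

theorem delta_mul_congr (m n : ℕ) (F : ℕ → K) : delta m n * F m = delta m n * F n := by
  by_cases h : m = n <;> simp [delta, h]

theorem sum_Iic_delta_mul (n : ℕ) {N : ℕ} (F : ℕ → K) (hn : n ≤ N) :
    ∑ v ∈ Finset.Iic N, delta v n * F v = F n := by
  simp [delta, hn]

theorem emit_mul_absorb (κ : WeightKind) (t : K) (n : ℕ) :
    emit κ t n * absorb κ t n = 1 - t ^ (n + 1) := by
  cases κ
  · simp only [emit, absorb, mul_one]
  · exact mul_neg_geom_sum t (n + 1)

theorem absorb_zero (κ : WeightKind) (t : K) : absorb κ t 0 = 1 := by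
  cases κ <;> simp [absorb]

/-- The weights of a monochrome vertex of color `c` with top spin `n` and bottom spin `m`, as a
matrix indexed by the left and right spins. -/
def monoMatrix (κ : WeightKind) (t z : K) (c : Fin r) (n m : ℕ) :
    Matrix (Option (Fin r)) (Option (Fin r)) K :=
  .of fun a b => monoWeight κ t z c a n b m

variable (κ : WeightKind) (t z : K) (c : Fin r) (n m : ℕ)

theorem monoMatrix_none_none : monoMatrix κ t z c n m none none = delta m n := rfl

theorem monoMatrix_some_none (d : Fin r) :
    monoMatrix κ t z c n m (some d) none =
      if d = c then delta m (n + 1) * (z * emit κ t n) else 0 := by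
  cases κ <;> simp [monoMatrix, monoWeight, emit, delta, ite_and]

theorem monoMatrix_none_some (d : Fin r) :
    monoMatrix κ t z c n m none (some d) =
      if d = c then delta n (m + 1) * absorb κ t m else 0 := by
  cases κ <;> simp [monoMatrix, monoWeight, absorb, delta, ite_and]

theorem monoMatrix_some_some (d e : Fin r) :
    monoMatrix κ t z c n m (some d) (some e) =
      if d = e then delta m n * if d = c then z else pass t c d n else 0 := by
  rcases lt_trichotomy d c with h | rfl | h
  · simp [monoMatrix, monoWeight, pass, delta, ite_and, h, h.ne]
  · simp [monoMatrix, monoWeight, delta, ite_and]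
  · simp [monoMatrix, monoWeight, pass, delta, ite_and, h.ne, h.ne', h.not_gt]

theorem monoMatrix_apply_some_of_ne {d : Fin r} (hd : d ≠ c) (x : Option (Fin r)) :
    monoMatrix κ t z c n m x (some d) = if x = some d then delta m n * pass t c d n else 0 := by
  cases x with
  | none => simp [monoMatrix_none_some, hd]
  | some e =>
    rcases eq_or_ne e d with rfl | h
    · simp [monoMatrix_some_some, hd]
    · simp [monoMatrix_some_some, h]

variable (ψ : Option (Fin r) → K)

theorem vecMul_monoMatrix_none :
    (ψ ᵥ* monoMatrix κ t z c n m) none =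
      delta m n * ψ none + delta m (n + 1) * (z * emit κ t n * ψ (some c)) := by
  simp only [Matrix.vecMul, dotProduct, Fintype.sum_option, monoMatrix_none_none,
    monoMatrix_some_none, mul_ite, mul_zero, Finset.sum_ite_eq', Finset.mem_univ, if_true]
  ring

theorem vecMul_monoMatrix_self :
    (ψ ᵥ* monoMatrix κ t z c n m) (some c) =
      delta n (m + 1) * (absorb κ t m * ψ none) + delta m n * (z * ψ (some c)) := by
  simp only [Matrix.vecMul, dotProduct, Fintype.sum_option, monoMatrix_none_some,
    monoMatrix_some_some, mul_ite, mul_zero, Finset.sum_ite_eq', Finset.mem_univ, if_true]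
  ring

theorem vecMul_monoMatrix_of_ne {d : Fin r} (hd : d ≠ c) :
    (ψ ᵥ* monoMatrix κ t z c n m) (some d) = delta m n * (pass t c d n * ψ (some d)) := by
  simp only [Matrix.vecMul, dotProduct, monoMatrix_apply_some_of_ne κ t z c n m hd, mul_ite,
    mul_zero, Finset.sum_ite_eq', Finset.mem_univ, if_true]
  ring

end MonochromeVertex

section MonochromePair

variable {K : Type*} [CommRing K] {r : ℕ}

theorem vecMul_kronecker_apply {S : Type*} [Fintype S] (Φ : S × S → K) (A B : Matrix S S K)
    (a b : S) :
    (Φ ᵥ* (A ⊗ₖ B)) (a, b) = ((fun y => ((fun x => Φ (x, y)) ᵥ* A) a) ᵥ* B) b := by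
  simp only [Matrix.vecMul, dotProduct, Matrix.kroneckerMap_apply, Fintype.sum_prod_type,
    Finset.sum_mul, mul_assoc]
  exact Finset.sum_comm

/-- The weights of two monochrome vertices of color `c` on top of each other, with top spin `n` and
bottom spin `m`, as a matrix indexed by the pairs of left and right spins. -/
def monoPair (κ : WeightKind) (t z₁ z₂ : K) (c : Fin r) (n m : ℕ) :
    Matrix (Option (Fin r) × Option (Fin r)) (Option (Fin r) × Option (Fin r)) K :=
  ∑ v ∈ Finset.Iic (n + 1), monoMatrix κ t z₁ c n v ⊗ₖ monoMatrix κ t z₂ c v m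

variable (κ : WeightKind) (t z₁ z₂ : K) (c : Fin r) (n m : ℕ)
    (Φ : Option (Fin r) × Option (Fin r) → K)

theorem vecMul_monoPair_apply (a b : Option (Fin r)) :
    (Φ ᵥ* monoPair κ t z₁ z₂ c n m) (a, b) = ∑ v ∈ Finset.Iic (n + 1),
      ((fun y => ((fun x => Φ (x, y)) ᵥ* monoMatrix κ t z₁ c n v) a) ᵥ*
        monoMatrix κ t z₂ c v m) b := by
  simp only [monoPair, Matrix.vecMul_sum, Finset.sum_apply, vecMul_kronecker_apply]

theorem vecMul_monoPair_none (b : Option (Fin r)) :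
    (Φ ᵥ* monoPair κ t z₁ z₂ c n m) (none, b) =
      ((fun y => Φ (none, y)) ᵥ* monoMatrix κ t z₂ c n m) b +
      z₁ * emit κ t n * ((fun y => Φ (some c, y)) ᵥ* monoMatrix κ t z₂ c (n + 1) m) b := by
  have upper (v : ℕ) : (fun y => ((fun x => Φ (x, y)) ᵥ* monoMatrix κ t z₁ c n v) none) =
      (delta v n : K) • (fun y => Φ (none, y)) +
        (delta v (n + 1) : K) • (z₁ * emit κ t n) • fun y => Φ (some c, y) := by
    ext y
    simp only [vecMul_monoMatrix_none, Pi.add_apply, Pi.smul_apply, smul_eq_mul]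
  simp only [vecMul_monoPair_apply, upper, Matrix.add_vecMul, Matrix.smul_vecMul, Pi.add_apply,
    Pi.smul_apply, smul_eq_mul, Finset.sum_add_distrib]
  rw [sum_Iic_delta_mul n _ n.le_succ, sum_Iic_delta_mul (n + 1) _ le_rfl]

theorem vecMul_monoPair_of_ne {d : Fin r} (hd : d ≠ c) (b : Option (Fin r)) :
    (Φ ᵥ* monoPair κ t z₁ z₂ c n m) (some d, b) =
      pass t c d n * ((fun y => Φ (some d, y)) ᵥ* monoMatrix κ t z₂ c n m) b := by
  have upper (v : ℕ) : (fun y => ((fun x => Φ (x, y)) ᵥ* monoMatrix κ t z₁ c n v) (some d)) =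
      (delta v n : K) • pass t c d n • fun y => Φ (some d, y) := by
    ext y
    simp only [vecMul_monoMatrix_of_ne _ _ _ _ _ _ _ hd, Pi.smul_apply, smul_eq_mul]
  simp only [vecMul_monoPair_apply, upper, Matrix.smul_vecMul, Pi.smul_apply, smul_eq_mul]
  rw [sum_Iic_delta_mul n _ n.le_succ]

theorem vecMul_monoPair_self (b : Option (Fin r)) :
    (Φ ᵥ* monoPair κ t z₁ z₂ c n m) (some c, b) =
      ∑ v ∈ Finset.Iic (n + 1), delta n (v + 1) *
        (absorb κ t v * ((fun y => Φ (none, y)) ᵥ* monoMatrix κ t z₂ c v m) b) +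
      z₁ * ((fun y => Φ (some c, y)) ᵥ* monoMatrix κ t z₂ c n m) b := by
  have upper (v : ℕ) : (fun y => ((fun x => Φ (x, y)) ᵥ* monoMatrix κ t z₁ c n v) (some c)) =
      (delta n (v + 1) : K) • absorb κ t v • (fun y => Φ (none, y)) +
        (delta v n : K) • z₁ • fun y => Φ (some c, y) := by
    ext y
    simp only [vecMul_monoMatrix_self, Pi.add_apply, Pi.smul_apply, smul_eq_mul]
  simp only [vecMul_monoPair_apply, upper, Matrix.add_vecMul, Matrix.smul_vecMul, Pi.add_apply,
    Pi.smul_apply, smul_eq_mul, Finset.sum_add_distrib]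
  rw [sum_Iic_delta_mul n _ n.le_succ]

theorem vecMul_monoPair_self_of_zero (b : Option (Fin r)) :
    (Φ ᵥ* monoPair κ t z₁ z₂ c 0 m) (some c, b) =
      z₁ * ((fun y => Φ (some c, y)) ᵥ* monoMatrix κ t z₂ c 0 m) b := by
  simp [vecMul_monoPair_self, delta]

theorem vecMul_monoPair_self_of_succ (b : Option (Fin r)) :
    (Φ ᵥ* monoPair κ t z₁ z₂ c (n + 1) m) (some c, b) =
      absorb κ t n * ((fun y => Φ (none, y)) ᵥ* monoMatrix κ t z₂ c n m) b +
      z₁ * ((fun y => Φ (some c, y)) ᵥ* monoMatrix κ t z₂ c (n + 1) m) b := by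
  simp [vecMul_monoPair_self, delta, Nat.le_add_right_of_le]

theorem vecMul_monoPair_none_none :
    (Φ ᵥ* monoPair κ t z₁ z₂ c n m) (none, none) =
      delta m n * Φ (none, none) +
      delta m (n + 1) * (emit κ t n * (z₂ * Φ (none, some c) + z₁ * Φ (some c, none))) +
      delta m (n + 2) * (z₁ * z₂ * emit κ t n * emit κ t (n + 1) * Φ (some c, some c)) := by
  rw [vecMul_monoPair_none, vecMul_monoMatrix_none, vecMul_monoMatrix_none]
  ring

theorem vecMul_monoPair_none_self :
    (Φ ᵥ* monoPair κ t z₁ z₂ c n m) (none, some c) =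
      delta n (m + 1) * (absorb κ t m * Φ (none, none)) +
      delta m n * (z₂ * Φ (none, some c) + z₁ * (1 - t ^ (n + 1)) * Φ (some c, none)) +
      delta m (n + 1) * (z₁ * z₂ * emit κ t n * Φ (some c, some c)) := by
  rw [vecMul_monoPair_none, vecMul_monoMatrix_self, vecMul_monoMatrix_self, delta_succ_succ,
    delta_comm n m, ← emit_mul_absorb κ]
  linear_combination z₁ * emit κ t n * Φ (some c, none) * delta_mul_congr m n (absorb κ t)

theorem vecMul_monoPair_none_of_ne {d : Fin r} (hd : d ≠ c) :
    (Φ ᵥ* monoPair κ t z₁ z₂ c n m) (none, some d) =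
      delta m n * (pass t c d n * Φ (none, some d)) +
      delta m (n + 1) * (z₁ * emit κ t n * pass t c d (n + 1) * Φ (some c, some d)) := by
  rw [vecMul_monoPair_none, vecMul_monoMatrix_of_ne _ _ _ _ _ _ _ hd,
    vecMul_monoMatrix_of_ne _ _ _ _ _ _ _ hd]
  ring

theorem vecMul_monoPair_of_ne_none {d : Fin r} (hd : d ≠ c) :
    (Φ ᵥ* monoPair κ t z₁ z₂ c n m) (some d, none) =
      delta m n * (pass t c d n * Φ (some d, none)) +
      delta m (n + 1) * (z₂ * emit κ t n * pass t c d n * Φ (some d, some c)) := by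
  rw [vecMul_monoPair_of_ne _ _ _ _ _ _ _ _ hd, vecMul_monoMatrix_none]
  ring

theorem vecMul_monoPair_of_ne_self {d : Fin r} (hd : d ≠ c) :
    (Φ ᵥ* monoPair κ t z₁ z₂ c n m) (some d, some c) =
      delta n (m + 1) * (absorb κ t m * pass t c d (m + 1) * Φ (some d, none)) +
      delta m n * (z₂ * pass t c d n * Φ (some d, some c)) := by
  rw [vecMul_monoPair_of_ne _ _ _ _ _ _ _ _ hd, vecMul_monoMatrix_self]
  linear_combination absorb κ t m * Φ (some d, none) *
      delta_mul_congr n (m + 1) (pass t c d)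

theorem vecMul_monoPair_of_ne_of_ne {d e : Fin r} (hd : d ≠ c) (he : e ≠ c) :
    (Φ ᵥ* monoPair κ t z₁ z₂ c n m) (some d, some e) =
      delta m n * (pass t c d n * pass t c e n * Φ (some d, some e)) := by
  rw [vecMul_monoPair_of_ne _ _ _ _ _ _ _ _ hd, vecMul_monoMatrix_of_ne _ _ _ _ _ _ _ he]
  ring

theorem vecMul_monoPair_self_none :
    (Φ ᵥ* monoPair κ t z₁ z₂ c n m) (some c, none) =
      delta n (m + 1) * (absorb κ t m * Φ (none, none)) +
      delta m n * (z₂ * (1 - t ^ n) * Φ (none, some c) + z₁ * Φ (some c, none)) +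
      delta m (n + 1) * (z₁ * z₂ * emit κ t n * Φ (some c, some c)) := by
  cases n with
  | zero =>
    rw [vecMul_monoPair_self_of_zero, vecMul_monoMatrix_none, delta_zero_succ]
    ring
  | succ n =>
    rw [vecMul_monoPair_self_of_succ, vecMul_monoMatrix_none, vecMul_monoMatrix_none,
      delta_succ_succ, delta_comm n m, ← emit_mul_absorb κ]
    linear_combination -Φ (none, none) * delta_mul_congr m n (absorb κ t)

theorem vecMul_monoPair_self_of_ne {d : Fin r} (hd : d ≠ c) :
    (Φ ᵥ* monoPair κ t z₁ z₂ c n m) (some c, some d) =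
      delta n (m + 1) * (absorb κ t m * pass t c d m * Φ (none, some d)) +
      delta m n * (z₁ * pass t c d n * Φ (some c, some d)) := by
  cases n with
  | zero =>
    rw [vecMul_monoPair_self_of_zero, vecMul_monoMatrix_of_ne _ _ _ _ _ _ _ hd, delta_zero_succ]
    ring
  | succ n =>
    rw [vecMul_monoPair_self_of_succ, vecMul_monoMatrix_of_ne _ _ _ _ _ _ _ hd,
      vecMul_monoMatrix_of_ne _ _ _ _ _ _ _ hd, delta_succ_succ, delta_comm n m]
    linear_combination -Φ (none, some d) *
      delta_mul_congr m n fun k => absorb κ t k * pass t c d k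

theorem vecMul_monoPair_self_self :
    (Φ ᵥ* monoPair κ t z₁ z₂ c n m) (some c, some c) =
      delta n (m + 2) * (absorb κ t m * absorb κ t (m + 1) * Φ (none, none)) +
      delta n (m + 1) * (absorb κ t m * (z₂ * Φ (none, some c) + z₁ * Φ (some c, none))) +
      delta m n * (z₁ * z₂ * Φ (some c, some c)) := by
  cases n with
  | zero =>
    rw [vecMul_monoPair_self_of_zero, vecMul_monoMatrix_self, delta_zero_succ, delta_zero_succ]
    ring
  | succ n =>
    rw [vecMul_monoPair_self_of_succ, vecMul_monoMatrix_self, vecMul_monoMatrix_self,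
      delta_succ_succ, delta_succ_succ, delta_comm n m]
    linear_combination
      absorb κ t m * Φ (none, none) * delta_mul_congr n (m + 1) (absorb κ t) -
        z₂ * Φ (none, some c) * delta_mul_congr m n (absorb κ t)

end MonochromePair

/-! ### The exchange relations for two rows -/

section Exchange

variable {K : Type*} [CommRing K] {r : ℕ}

/-- The two relations that express the vectors `Ψ` of partition functions of two rows with spectral
parameters `z₂, z₁` at the pair of spins `u, v` through the vectors `Φ` of two rows with spectral
parameters `z₁, z₂`. -/
structure ExchangePair {S : Type*} (t z₁ z₂ ζ ζ' : K) (Φ Ψ : S × S → K) (u v : S) : Prop where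
  fwd : (z₁ - z₂) * Φ (v, u) = (1 - t) * ζ * Φ (u, v) + (t * z₁ - z₂) * Ψ (u, v)
  bwd : t * (z₁ - z₂) * Φ (u, v) = (1 - t) * ζ' * Φ (v, u) + (t * z₁ - z₂) * Ψ (v, u)

/-- The exchange relations between the vectors `Φ` and `Ψ` of partition functions of two rows, with
spectral parameters `z₁, z₂` and `z₂, z₁` respectively, after the monochrome vertices of the colors
`k ≥ p` of a column. A relation between two colors separated by `p` has the parameters of a relation
with the vacuum; the others have them interchanged. -/
structure Exchange (t z₁ z₂ : K) (p : ℕ) (Φ Ψ : Option (Fin r) × Option (Fin r) → K) : Prop where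
  diag : ∀ a, (t * z₁ - z₂) * Ψ (a, a) = (t * z₁ - z₂) * Φ (a, a)
  vac : ∀ e, ExchangePair t z₁ z₂ z₁ z₂ Φ Ψ (some e) none
  straddle : ∀ a b : Fin r, a.1 < p → p ≤ b.1 →
    ExchangePair t z₁ z₂ z₁ z₂ Φ Ψ (some a) (some b)
  col : ∀ a b : Fin r, a < b → ¬ (a.1 < p ∧ p ≤ b.1) →
    ExchangePair t z₁ z₂ z₂ z₁ Φ Ψ (some a) (some b)

theorem pass_of_lt {t : K} {c d : Fin r} (h : d < c) (n : ℕ) : pass t c d n = 1 := if_pos h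

theorem pass_of_gt {t : K} {c d : Fin r} (h : c < d) (n : ℕ) : pass t c d n = t ^ n :=
  if_neg h.not_gt

variable {t z₁ z₂ : K} {Φ Ψ : Option (Fin r) × Option (Fin r) → K} {c : Fin r} (κ : WeightKind)
  (n m : ℕ)

theorem ExchangePair.vecMul_monoPair_of_ne {ζ ζ' : K} {a b : Fin r} (ha : a ≠ c) (hb : b ≠ c)
    (h : ExchangePair t z₁ z₂ ζ ζ' Φ Ψ (some a) (some b)) :
    ExchangePair t z₁ z₂ ζ ζ' (Φ ᵥ* monoPair κ t z₁ z₂ c n m) (Ψ ᵥ* monoPair κ t z₂ z₁ c n m)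
      (some a) (some b) := by
  constructor <;>
    simp only [vecMul_monoPair_of_ne_of_ne _ _ _ _ _ _ _ _ ha hb,
      vecMul_monoPair_of_ne_of_ne _ _ _ _ _ _ _ _ hb ha]
  · linear_combination delta m n * pass t c a n * pass t c b n * h.fwd
  · linear_combination delta m n * pass t c a n * pass t c b n * h.bwd

namespace Exchange

theorem vecMul_monoPair_diag (h : Exchange t z₁ z₂ (c + 1) Φ Ψ) (a : Option (Fin r)) :
    (t * z₁ - z₂) * (Ψ ᵥ* monoPair κ t z₂ z₁ c n m) (a, a) =
      (t * z₁ - z₂) * (Φ ᵥ* monoPair κ t z₁ z₂ c n m) (a, a) := by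
  have vac_sum : (t * z₁ - z₂) * (z₁ * Ψ (none, some c) + z₂ * Ψ (some c, none)) =
      (t * z₁ - z₂) * (z₂ * Φ (none, some c) + z₁ * Φ (some c, none)) := by
    linear_combination -z₂ * (h.vac c).fwd - z₁ * (h.vac c).bwd
  cases a with
  | none =>
    rw [vecMul_monoPair_none_none, vecMul_monoPair_none_none]
    linear_combination delta m n * h.diag none + delta m (n + 1) * emit κ t n * vac_sum +
      delta m (n + 2) * z₁ * z₂ * emit κ t n * emit κ t (n + 1) * h.diag (some c)
  | some d =>
    rcases eq_or_ne d c with rfl | hd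
    · rw [vecMul_monoPair_self_self, vecMul_monoPair_self_self]
      linear_combination
        delta n (m + 2) * absorb κ t m * absorb κ t (m + 1) * h.diag none +
          delta n (m + 1) * absorb κ t m * vac_sum + delta m n * z₁ * z₂ * h.diag (some d)
    · rw [vecMul_monoPair_of_ne_of_ne _ _ _ _ _ _ _ _ hd hd,
        vecMul_monoPair_of_ne_of_ne _ _ _ _ _ _ _ _ hd hd]
      linear_combination delta m n * pass t c d n ^ 2 * h.diag (some d)

theorem vecMul_monoPair_vac_self (h : Exchange t z₁ z₂ (c + 1) Φ Ψ) :
    ExchangePair t z₁ z₂ z₁ z₂ (Φ ᵥ* monoPair κ t z₁ z₂ c n m) (Ψ ᵥ* monoPair κ t z₂ z₁ c n m)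
      (some c) none where
  fwd := by
    simp only [vecMul_monoPair_none_self, vecMul_monoPair_self_none]
    linear_combination -delta n (m + 1) * absorb κ t m * h.diag none +
      delta m n * (z₂ * (h.vac c).fwd + z₁ * (1 - t ^ n) * (h.vac c).bwd) -
      delta m (n + 1) * z₁ * z₂ * emit κ t n * h.diag (some c)
  bwd := by
    simp only [vecMul_monoPair_none_self, vecMul_monoPair_self_none]
    linear_combination -delta n (m + 1) * absorb κ t m * h.diag none +
      delta m n * (z₁ * (h.vac c).bwd + z₂ * (1 - t ^ (n + 1)) * (h.vac c).fwd) -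
      delta m (n + 1) * z₁ * z₂ * emit κ t n * h.diag (some c)

theorem vecMul_monoPair_vac_of_ne (h : Exchange t z₁ z₂ (c + 1) Φ Ψ) {e : Fin r} (he : e ≠ c) :
    ExchangePair t z₁ z₂ z₁ z₂ (Φ ᵥ* monoPair κ t z₁ z₂ c n m) (Ψ ᵥ* monoPair κ t z₂ z₁ c n m)
      (some e) none := by
  rcases he.lt_or_gt with hec | hce
  · have col_ec := h.col e c hec fun hc => hc.2.not_gt c.1.lt_succ_self
    constructor <;>
      simp only [vecMul_monoPair_none_of_ne _ _ _ _ _ _ _ _ he,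
        vecMul_monoPair_of_ne_none _ _ _ _ _ _ _ _ he, pass_of_lt hec]
    · linear_combination delta m n * (h.vac e).fwd + delta m (n + 1) * z₁ * emit κ t n * col_ec.fwd
    · linear_combination delta m n * (h.vac e).bwd + delta m (n + 1) * z₂ * emit κ t n * col_ec.bwd
  · have straddle_ce := h.straddle c e c.1.lt_succ_self hce
    constructor <;>
      simp only [vecMul_monoPair_none_of_ne _ _ _ _ _ _ _ _ he,
        vecMul_monoPair_of_ne_none _ _ _ _ _ _ _ _ he, pass_of_gt hce]
    · linear_combination delta m n * t ^ n * (h.vac e).fwd +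
        delta m (n + 1) * z₁ * emit κ t n * t ^ n * straddle_ce.bwd
    · linear_combination delta m n * t ^ n * (h.vac e).bwd +
        delta m (n + 1) * z₂ * emit κ t n * t ^ (n + 1) * straddle_ce.fwd

theorem vecMul_monoPair_straddle (h : Exchange t z₁ z₂ (c + 1) Φ Ψ) {a b : Fin r} (ha : a < c)
    (hb : c ≤ b) :
    ExchangePair t z₁ z₂ z₁ z₂ (Φ ᵥ* monoPair κ t z₁ z₂ c n m) (Ψ ᵥ* monoPair κ t z₂ z₁ c n m)
      (some a) (some b) := by
  rcases hb.eq_or_lt with rfl | hcb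
  · have col_ac := h.col a c ha fun hc => hc.2.not_gt c.1.lt_succ_self
    constructor <;>
      simp only [vecMul_monoPair_self_of_ne _ _ _ _ _ _ _ _ ha.ne,
        vecMul_monoPair_of_ne_self _ _ _ _ _ _ _ _ ha.ne, pass_of_lt ha]
    · linear_combination
        delta n (m + 1) * absorb κ t m * (h.vac a).fwd + delta m n * z₁ * col_ac.fwd
    · linear_combination
        delta n (m + 1) * absorb κ t m * (h.vac a).bwd + delta m n * z₂ * col_ac.bwd
  · exact (h.straddle a b (Nat.lt_succ_of_lt ha) hcb).vecMul_monoPair_of_ne κ n m ha.ne hcb.ne'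

theorem vecMul_monoPair_col (h : Exchange t z₁ z₂ (c + 1) Φ Ψ) {a b : Fin r} (hab : a < b)
    (hc : ¬ (a.1 < c.1 ∧ c.1 ≤ b.1)) :
    ExchangePair t z₁ z₂ z₂ z₁ (Φ ᵥ* monoPair κ t z₁ z₂ c n m) (Ψ ᵥ* monoPair κ t z₂ z₁ c n m)
      (some a) (some b) := by
  rcases eq_or_ne a c with rfl | hac
  · have straddle_ab := h.straddle a b a.1.lt_succ_self hab
    constructor <;>
      simp only [vecMul_monoPair_self_of_ne _ _ _ _ _ _ _ _ hab.ne',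
        vecMul_monoPair_of_ne_self _ _ _ _ _ _ _ _ hab.ne', pass_of_gt hab]
    · linear_combination delta n (m + 1) * absorb κ t m * t ^ m * (h.vac b).bwd +
        delta m n * z₂ * t ^ n * straddle_ab.fwd
    · linear_combination delta n (m + 1) * absorb κ t m * t ^ (m + 1) * (h.vac b).fwd +
        delta m n * z₁ * t ^ n * straddle_ab.bwd
  · have hbc : b ≠ c := by rintro rfl; exact hc ⟨hab, le_rfl⟩
    exact (h.col a b hab (by omega)).vecMul_monoPair_of_ne κ n m hac hbc

theorem vecMul_monoPair (h : Exchange t z₁ z₂ (c + 1) Φ Ψ) :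
    Exchange t z₁ z₂ c (Φ ᵥ* monoPair κ t z₁ z₂ c n m) (Ψ ᵥ* monoPair κ t z₂ z₁ c n m) where
  diag := h.vecMul_monoPair_diag κ n m
  vac e := by
    rcases eq_or_ne e c with rfl | he
    · exact h.vecMul_monoPair_vac_self κ n m
    · exact h.vecMul_monoPair_vac_of_ne κ n m he
  straddle _ _ := h.vecMul_monoPair_straddle κ n m
  col _ _ := h.vecMul_monoPair_col κ n m

theorem of_zero (h : Exchange t z₁ z₂ 0 Φ Ψ) : Exchange t z₁ z₂ r Φ Ψ where
  diag := h.diag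
  vac := h.vac
  straddle _ b _ hb := absurd hb b.2.not_ge
  col a b hab _ := h.col a b hab fun hc => a.1.not_lt_zero hc.1

end Exchange

end Exchange

section Rows

variable {K : Type*} [CommRing K] {n r : ℕ}

/-- The weights of a fused vertex with top spin `T` and bottom spin `V`, as a matrix indexed by the
left and right spins. -/
def fusedMatrix (κ : WeightKind) (t z : K) (T V : Fin r → ℕ) :
    Matrix (Option (Fin r)) (Option (Fin r)) K :=
  .of fun a b => fusedWeight κ t z a T b V

/-- The weights of two fused vertices on top of each other, as a matrix indexed by the pairs of left
and right spins. -/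
def fusedPair (κ : WeightKind) (t z₁ z₂ : K) (T B : Fin r → ℕ) :
    Matrix (Option (Fin r) × Option (Fin r)) (Option (Fin r) × Option (Fin r)) K :=
  ∑ V ∈ Finset.Iic (T + 1), fusedMatrix κ t z₁ T V ⊗ₖ fusedMatrix κ t z₂ V B

/-- The transfer matrix of a row of fused vertices with top spins `T` and bottom spins `V`. -/
def rowMatrix (κ : WeightKind) (t z : K) (T V : Fin n → Fin r → ℕ) :
    Matrix (Option (Fin r)) (Option (Fin r)) K :=
  pathSum fun p => fusedMatrix κ t z (T p) (V p)

variable (κ : WeightKind) (t z₁ z₂ : K)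

theorem fusedMatrix_eq_pathSum (z : K) (T V : Fin r → ℕ) :
    fusedMatrix κ t z T V = pathSum fun k => monoMatrix κ t z k.rev (T k.rev) (V k.rev) := rfl

theorem fusedPair_eq_pathSum (T B : Fin r → ℕ) : fusedPair κ t z₁ z₂ T B =
    pathSum fun k => monoPair κ t z₁ z₂ k.rev (T k.rev) (B k.rev) :=
  sum_pathSum_kronecker_pathSum Fin.revPerm (fun c => Finset.Iic (T c + 1))
    (fun c v => monoMatrix κ t z₁ c (T c) v) fun c v => monoMatrix κ t z₂ c v (B c)

theorem sum_rowMatrix_kronecker_rowMatrix (T B : Fin n → Fin r → ℕ) :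
    ∑ V ∈ Finset.Iic (T + 1), rowMatrix κ t z₁ T V ⊗ₖ rowMatrix κ t z₂ V B =
      pathSum fun p => fusedPair κ t z₁ z₂ (T p) (B p) :=
  sum_pathSum_kronecker_pathSum (Equiv.refl _) (fun p => Finset.Iic (T p + 1))
    (fun p V => fusedMatrix κ t z₁ (T p) V) fun p V => fusedMatrix κ t z₂ V (B p)

variable {t z₁ z₂} {Φ Ψ : Option (Fin r) × Option (Fin r) → K}

theorem Exchange.vecMul_fusedPair (h : Exchange t z₁ z₂ r Φ Ψ) (T B : Fin r → ℕ) :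
    Exchange t z₁ z₂ r (Φ ᵥ* fusedPair κ t z₁ z₂ T B) (Ψ ᵥ* fusedPair κ t z₂ z₁ T B) := by
  rw [fusedPair_eq_pathSum, fusedPair_eq_pathSum]
  refine of_zero ?_
  have through_colors := vecMul_pathSum_induction₂ (P := fun k => Exchange t z₁ z₂ k.rev.1)
    (f := fun k => monoPair κ t z₁ z₂ k.rev (T k.rev) (B k.rev))
    (f' := fun k => monoPair κ t z₂ z₁ k.rev (T k.rev) (B k.rev)) (fun k φ φ' hk => ?_)
    (φ := Φ) (φ' := Ψ) h
  · simpa using through_colors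
  · rw [Fin.rev_castSucc] at hk
    rw [Fin.rev_succ]
    exact hk.vecMul_monoPair κ _ _

theorem Exchange.single_none (p : ℕ) :
    Exchange t z₁ z₂ p (Pi.single ((none : Option (Fin r)), (none : Option (Fin r))) 1)
      (Pi.single (none, none) 1) where
  diag _ := rfl
  vac e := by constructor <;> simp
  straddle a b _ _ := by constructor <;> simp
  col a b _ _ := by constructor <;> simp

theorem sum_rowMatrix_mul_rowMatrix_exchange (T B : Fin n → Fin r → ℕ) {a b : Fin r} (hab : a < b) :
    (z₁ - z₂) * ∑ V ∈ Finset.Iic (T + 1),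
        rowMatrix κ t z₁ T V none (some b) * rowMatrix κ t z₂ V B none (some a) =
      (1 - t) * z₂ * ∑ V ∈ Finset.Iic (T + 1),
        rowMatrix κ t z₁ T V none (some a) * rowMatrix κ t z₂ V B none (some b) +
      (t * z₁ - z₂) * ∑ V ∈ Finset.Iic (T + 1),
        rowMatrix κ t z₂ T V none (some a) * rowMatrix κ t z₁ V B none (some b) := by
  have exchange := vecMul_pathSum_induction₂ (P := fun _ => Exchange t z₁ z₂ r)
    (fun p φ φ' h => h.vecMul_fusedPair κ (T p) (B p)) (Exchange.single_none r)
  rw [← sum_rowMatrix_kronecker_rowMatrix, ← sum_rowMatrix_kronecker_rowMatrix] at exchange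
  simpa [Matrix.single_one_vecMul, Matrix.row, Matrix.sum_apply] using
    (exchange.col a b hab fun h => b.2.not_ge h.2).fwd

end Rows

/-! ### Reduced words and Demazure-Lusztig operators -/

section Length

variable {r : ℕ}

theorem simpleRefl_mul_cancel (i : Fin (r - 1)) (w : Equiv.Perm (Fin r)) :
    simpleRefl i * (simpleRefl i * w) = w := by
  rw [← mul_assoc, simpleRefl, Equiv.swap_mul_self, one_mul]

theorem lo_lt_hi (i : Fin (r - 1)) : lo i < hi i := Fin.mk_lt_mk.2 i.1.lt_succ_self

theorem simpleRefl_lo (i : Fin (r - 1)) : simpleRefl i (lo i) = hi i := Equiv.swap_apply_left _ _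

theorem simpleRefl_hi (i : Fin (r - 1)) : simpleRefl i (hi i) = lo i := Equiv.swap_apply_right _ _

theorem inv_simpleRefl_mul_apply (i : Fin (r - 1)) (w : Equiv.Perm (Fin r)) (x : Fin r) :
    (simpleRefl i * w)⁻¹ x = w⁻¹ (simpleRefl i x) := by
  rw [mul_inv_rev, simpleRefl, Equiv.swap_inv, Equiv.Perm.mul_apply]

theorem simpleRefl_lt_simpleRefl_iff (i : Fin (r - 1)) {x y : Fin r}
    (h : ¬ (x = lo i ∧ y = hi i)) (h' : ¬ (x = hi i ∧ y = lo i)) :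
    simpleRefl i x < simpleRefl i y ↔ x < y := by
  have val_simpleRefl (x : Fin r) : (simpleRefl i x).1 =
      if x.1 = i.1 then i.1 + 1 else if x.1 = i.1 + 1 then i.1 else x.1 := by
    simp only [simpleRefl, Equiv.swap_apply_def, lo, hi, Fin.ext_iff]
    split_ifs <;> rfl
  simp only [lo, hi, Fin.ext_iff] at h h'
  rw [Fin.lt_def, Fin.lt_def, val_simpleRefl, val_simpleRefl]
  split_ifs <;> omega

theorem len_simpleRefl_mul_of_lt {i : Fin (r - 1)} {w : Equiv.Perm (Fin r)}
    (h : w⁻¹ (lo i) < w⁻¹ (hi i)) : len (simpleRefl i * w) = len w + 1 := by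
  have not_inversion : (w⁻¹ (lo i), w⁻¹ (hi i)) ∉
      Finset.univ.filter fun p : Fin r × Fin r => p.1 < p.2 ∧ w p.2 < w p.1 := by
    simp [(lo_lt_hi i).le]
  rw [len, len, ← Finset.card_insert_of_notMem not_inversion]
  congr 1
  ext ⟨a, b⟩
  rw [Finset.mem_filter, Finset.mem_insert, Finset.mem_filter]
  simp only [Finset.mem_univ, true_and, Prod.mk.injEq, Equiv.Perm.mul_apply,
    Equiv.Perm.eq_inv_iff_eq]
  by_cases h_lo_hi : w a = lo i ∧ w b = hi i
  · have hab : a < b := by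
      rwa [Equiv.Perm.eq_inv_iff_eq.2 h_lo_hi.1, Equiv.Perm.eq_inv_iff_eq.2 h_lo_hi.2]
    simp [h_lo_hi, simpleRefl_lo, simpleRefl_hi, lo_lt_hi, hab]
  by_cases h_hi_lo : w a = hi i ∧ w b = lo i
  · have hab : ¬ a < b := by
      rw [Equiv.Perm.eq_inv_iff_eq.2 h_hi_lo.1, Equiv.Perm.eq_inv_iff_eq.2 h_hi_lo.2]
      exact h.not_gt
    simp [h_lo_hi, hab]
  · rw [simpleRefl_lt_simpleRefl_iff i (by tauto) (by tauto)]
    simp [h_lo_hi]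

theorem len_simpleRefl_mul_of_gt {i : Fin (r - 1)} {w : Equiv.Perm (Fin r)}
    (h : w⁻¹ (hi i) < w⁻¹ (lo i)) : len w = len (simpleRefl i * w) + 1 := by
  rw [← len_simpleRefl_mul_of_lt (i := i), simpleRefl_mul_cancel]
  rwa [inv_simpleRefl_mul_apply, inv_simpleRefl_mul_apply, simpleRefl_lo, simpleRefl_hi]

theorem inv_lo_lt_or_gt (i : Fin (r - 1)) (w : Equiv.Perm (Fin r)) :
    w⁻¹ (lo i) < w⁻¹ (hi i) ∨ w⁻¹ (hi i) < w⁻¹ (lo i) :=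
  lt_or_gt_of_ne (w⁻¹.injective.ne (lo_lt_hi i).ne)

theorem len_lt_len_simpleRefl_mul_iff {i : Fin (r - 1)} {w : Equiv.Perm (Fin r)} :
    len w < len (simpleRefl i * w) ↔ w⁻¹ (lo i) < w⁻¹ (hi i) := by
  rcases inv_lo_lt_or_gt i w with h | h
  · exact iff_of_true (by rw [len_simpleRefl_mul_of_lt h]; omega) h
  · exact iff_of_false (by rw [len_simpleRefl_mul_of_gt h]; omega) h.not_gt

theorem len_one : len (1 : Equiv.Perm (Fin r)) = 0 := by
  rw [len, Finset.card_eq_zero, Finset.filter_eq_empty_iff]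
  exact fun p _ h => h.1.not_gt h.2

theorem len_inv (w : Equiv.Perm (Fin r)) : len w⁻¹ = len w := by
  refine Finset.card_bij' (fun p _ => (w⁻¹ p.2, w⁻¹ p.1)) (fun p _ => (w p.2, w p.1))
    ?_ ?_ ?_ ?_ <;> simp +contextual

theorem exists_len_eq_len_simpleRefl_mul_add_one {w : Equiv.Perm (Fin r)} (hw : w ≠ 1) :
    ∃ i, len w = len (simpleRefl i * w) + 1 := by
  suffices h : ∃ i : Fin (r - 1), ¬ w⁻¹ (lo i) < w⁻¹ (hi i) by
    obtain ⟨i, hi⟩ := h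
    exact ⟨i, len_simpleRefl_mul_of_gt ((inv_lo_lt_or_gt i w).resolve_left hi)⟩
  by_contra! increasing
  cases r with
  | zero => exact hw (Subsingleton.elim _ _)
  | succ r =>
    have mono : StrictMono (w⁻¹ : Equiv.Perm (Fin (r + 1))) :=
      Fin.strictMono_iff_lt_succ.2 increasing
    have inv_eq_id := (mono.range_inj strictMono_id).1 (by simp)
    exact hw (inv_eq_one.1 (Equiv.ext (congrFun inv_eq_id)))

theorem exists_isReducedWord (w : Equiv.Perm (Fin r)) : ∃ l, IsReducedWord w l := by
  induction hk : len w generalizing w with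
  | zero =>
    have hw : w = 1 := by
      by_contra hw
      obtain ⟨i, hi⟩ := exists_len_eq_len_simpleRefl_mul_add_one hw
      omega
    exact ⟨[], hw.symm, hk.symm⟩
  | succ k ih =>
    obtain ⟨i, hi⟩ := exists_len_eq_len_simpleRefl_mul_add_one (w := w) (by
      rintro rfl
      rw [len_one] at hk
      omega)
    obtain ⟨l, prod_eq, length_eq⟩ := ih (simpleRefl i * w) (by omega)
    refine ⟨i :: l, ?_, ?_⟩
    · rw [List.map_cons, List.prod_cons, prod_eq, simpleRefl_mul_cancel]
    · rw [List.length_cons, length_eq, hi]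

theorem len_prod_le (l : List (Fin (r - 1))) : len (l.map simpleRefl).prod ≤ l.length := by
  induction l with
  | nil => exact len_one.le
  | cons i l ih =>
    rw [List.map_cons, List.prod_cons, List.length_cons]
    rcases inv_lo_lt_or_gt i (l.map simpleRefl).prod with h | h
    · have len_eq := len_simpleRefl_mul_of_lt h
      omega
    · have len_eq := len_simpleRefl_mul_of_gt h
      omega

theorem IsReducedWord.tail {w : Equiv.Perm (Fin r)} {i : Fin (r - 1)} {l : List (Fin (r - 1))}
    (h : IsReducedWord w (i :: l)) :
    IsReducedWord (simpleRefl i * w) l ∧ len (simpleRefl i * w) < len w := by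
  obtain ⟨prod_eq, length_eq⟩ := h
  have prod_tail : (l.map simpleRefl).prod = simpleRefl i * w := by
    rw [← prod_eq, List.map_cons, List.prod_cons, simpleRefl_mul_cancel]
  have len_le := len_prod_le l
  rw [prod_tail] at len_le
  rw [List.length_cons] at length_eq
  rcases inv_lo_lt_or_gt i w with h | h
  · have len_eq := len_simpleRefl_mul_of_lt h
    omega
  · have len_eq := len_simpleRefl_mul_of_gt h
    exact ⟨⟨prod_tail, by omega⟩, by omega⟩

end Length

section PermVars

variable {R : Type*} [CommRing R] {r : ℕ}

theorem permVars_algebraMap (σ : Equiv.Perm (Fin r)) (p : MvPolynomial (Fin r) R) :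
    permVars R σ (algebraMap _ _ p) = algebraMap _ _ (MvPolynomial.rename σ p) :=
  IsFractionRing.ringEquivOfRingEquiv_algebraMap _ _

theorem permVars_zvar (σ : Equiv.Perm (Fin r)) (i : Fin r) :
    permVars R σ (zvar R i) = zvar R (σ i) := by
  rw [zvar, permVars_algebraMap, MvPolynomial.rename_X, zvar]

theorem permVars_param (σ : Equiv.Perm (Fin r)) (t : Rˣ) :
    permVars R σ (param r t) = param r t := by
  rw [param, IsScalarTower.algebraMap_apply R (MvPolynomial (Fin r) R) (RatField R r),
    permVars_algebraMap, AlgHom.commutes]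

end PermVars

section DemazureLusztig

variable {R : Type*} [CommRing R] [IsDomain R] {r : ℕ}

theorem permVars_permVars (σ ρ : Equiv.Perm (Fin r)) (f : RatField R r) :
    permVars R σ (permVars R ρ f) = permVars R (σ * ρ) f := by
  obtain ⟨a, b, -, rfl⟩ := IsFractionRing.div_surjective (A := MvPolynomial (Fin r) R) f
  simp only [map_div₀, permVars_algebraMap, MvPolynomial.rename_rename, Equiv.Perm.coe_mul]

theorem permVars_one (f : RatField R r) : permVars R 1 f = f := by
  obtain ⟨a, b, -, rfl⟩ := IsFractionRing.div_surjective (A := MvPolynomial (Fin r) R) f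
  simp only [map_div₀, permVars_algebraMap, Equiv.Perm.coe_one, MvPolynomial.rename_id_apply]

theorem permVars_simpleRefl_permVars_simpleRefl (i : Fin (r - 1)) (f : RatField R r) :
    permVars R (simpleRefl i) (permVars R (simpleRefl i) f) = f := by
  rw [permVars_permVars, simpleRefl, Equiv.swap_mul_self, permVars_one]

theorem zvar_injective : Function.Injective (zvar R : Fin r → RatField R r) :=
  (IsFractionRing.injective (MvPolynomial (Fin r) R) (RatField R r)).comp
    (MvPolynomial.X_injective (R := R))

theorem zvar_ne_zero (i : Fin r) : zvar R i ≠ 0 := by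
  rw [zvar, Ne, FaithfulSMul.algebraMap_eq_zero_iff]
  exact MvPolynomial.X_ne_zero i

theorem zvar_lo_ne_zvar_hi (i : Fin (r - 1)) : zvar R (lo i) ≠ zvar R (hi i) :=
  zvar_injective.ne (lo_lt_hi i).ne

theorem param_ne_zero (t : Rˣ) : param r t ≠ 0 := (t.isUnit.map (algebraMap R _)).ne_zero

theorem zroot_ne_zero (i : Fin (r - 1)) : zroot R i ≠ 0 :=
  div_ne_zero (zvar_ne_zero _) (zvar_ne_zero _)

theorem zroot_ne_one (i : Fin (r - 1)) : zroot R i ≠ 1 := by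
  rw [zroot, Ne, div_eq_one_iff_eq (zvar_ne_zero _)]
  exact zvar_lo_ne_zvar_hi i

theorem permVars_zroot (i : Fin (r - 1)) :
    permVars R (simpleRefl i) (zroot R i) = (zroot R i)⁻¹ := by
  rw [zroot, map_div₀, permVars_zvar, permVars_zvar, simpleRefl_lo, simpleRefl_hi, inv_div]

theorem demLusInv_demLus (t : Rˣ) (i : Fin (r - 1)) (f : RatField R r) :
    demLusInv t i (demLus t i f) = f := by
  have param_ne := param_ne_zero (r := r) t
  have root_ne := zroot_ne_zero (R := R) i
  have root_sub_ne := sub_ne_zero.2 (zroot_ne_one (R := R) i)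
  have sub_root_ne := sub_ne_zero.2 (zroot_ne_one (R := R) i).symm
  simp only [demLusInv, demLus, map_sub, map_div₀, map_mul, map_one, permVars_zroot,
    permVars_simpleRefl_permVars_simpleRefl, permVars_param]
  field_simp
  ring

theorem eq_demLus_of_exchange (t : Rˣ) (i : Fin (r - 1)) {f g : RatField R r}
    (h : (zvar R (lo i) - zvar R (hi i)) * g = (1 - param r t) * zvar R (hi i) * f +
      (param r t * zvar R (lo i) - zvar R (hi i)) * permVars R (simpleRefl i) f) :
    g = demLus t i f := by
  have hi_ne := zvar_ne_zero (R := R) (hi i)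
  have sub_ne := sub_ne_zero.2 (zvar_lo_ne_zvar_hi (R := R) i)
  have root_sub_ne := sub_ne_zero.2 (zroot_ne_one (R := R) i)
  refine mul_left_cancel₀ sub_ne (h.trans ?_)
  unfold demLus
  unfold zroot at root_sub_ne ⊢
  field_simp
  ring

end DemazureLusztig

/-! ### Transfer operators -/

section RowOperators

variable {K : Type*} [CommRing K] {n r : ℕ} (κ : WeightKind) (t : K)

theorem monoMatrix_eq_zero (z : K) (c : Fin r) {n m : ℕ} (h : ¬ m ≤ n + 1) :
    monoMatrix κ t z c n m = 0 := by
  have ne : m ≠ n := by omega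
  have ne_succ : m ≠ n + 1 := by omega
  have not_pred : n ≠ m + 1 := by omega
  ext (_ | a) (_ | b) <;> simp [monoMatrix, monoWeight, ne, ne_succ, not_pred]

theorem fusedMatrix_eq_zero (z : K) {T V : Fin r → ℕ} (h : ¬ V ≤ T + 1) :
    fusedMatrix κ t z T V = 0 := by
  obtain ⟨c, hc⟩ := not_forall.1 h
  rw [fusedMatrix_eq_pathSum]
  refine pathSum_eq_zero (k := c.rev) (monoMatrix_eq_zero κ t z _ ?_)
  rwa [Fin.rev_rev]

theorem rowMatrix_eq_zero (z : K) {T V : Fin n → Fin r → ℕ} (h : ¬ V ≤ T + 1) :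
    rowMatrix κ t z T V = 0 := by
  obtain ⟨p, hp⟩ := not_forall.1 h
  exact pathSum_eq_zero (k := p) (fusedMatrix_eq_zero κ t z hp)

/-- The transfer operator of a row with spectral parameter `z`, left spin `+` and right spin `d`,
acting on the functions of the vertical spins below the row. -/
def rowOperator (z : K) (d : Fin r) : Module.End K ((Fin n → Fin r → ℕ) → K) where
  toFun F T := ∑ V ∈ Finset.Iic (T + 1), rowMatrix κ t z T V none (some d) * F V
  map_add' F G := by ext T; simp [mul_add, Finset.sum_add_distrib]
  map_smul' x F := by ext T; simp [Finset.mul_sum, mul_left_comm]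

theorem rowOperator_apply_of_le (z : K) (d : Fin r) (F : (Fin n → Fin r → ℕ) → K)
    {T B : Fin n → Fin r → ℕ} (hTB : T + 1 ≤ B) :
    rowOperator κ t z d F T = ∑ V ∈ Finset.Iic B, rowMatrix κ t z T V none (some d) * F V := by
  refine Finset.sum_subset (Finset.Iic_subset_Iic.2 hTB) fun V _ hV => ?_
  rw [rowMatrix_eq_zero κ t z (by simpa using hV), Matrix.zero_apply, zero_mul]

theorem rowOperator_rowOperator_apply (z₁ z₂ : K) (a b : Fin r) (F : (Fin n → Fin r → ℕ) → K)
    (T : Fin n → Fin r → ℕ) :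
    rowOperator κ t z₁ a (rowOperator κ t z₂ b F) T = ∑ B ∈ Finset.Iic (T + 1 + 1),
      (∑ V ∈ Finset.Iic (T + 1),
        rowMatrix κ t z₁ T V none (some a) * rowMatrix κ t z₂ V B none (some b)) * F B := by
  rw [rowOperator_apply_of_le κ t z₁ a _ le_rfl]
  simp only [Finset.sum_mul]
  rw [Finset.sum_comm]
  refine Finset.sum_congr rfl fun V hV => ?_
  rw [rowOperator_apply_of_le κ t z₂ b F (add_le_add_left (Finset.mem_Iic.1 hV) 1),
    Finset.mul_sum]
  exact Finset.sum_congr rfl fun B _ => (mul_assoc _ _ _).symm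

theorem rowOperator_exchange (z₁ z₂ : K) {a b : Fin r} (hab : a < b) :
    (z₁ - z₂) • (rowOperator (n := n) κ t z₁ b * rowOperator κ t z₂ a) =
      ((1 - t) * z₂) • (rowOperator κ t z₁ a * rowOperator κ t z₂ b) +
        (t * z₁ - z₂) • (rowOperator κ t z₂ a * rowOperator κ t z₁ b) := by
  ext F T
  simp only [LinearMap.add_apply, LinearMap.smul_apply, Pi.add_apply, Pi.smul_apply, smul_eq_mul,
    Module.End.mul_apply, rowOperator_rowOperator_apply, Finset.mul_sum (Finset.Iic (T + 1 + 1)),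
    ← mul_assoc]
  rw [← Finset.sum_add_distrib]
  refine Finset.sum_congr rfl fun B _ => ?_
  rw [sum_rowMatrix_mul_rowMatrix_exchange κ T B hab, add_mul]

/-- The transfer operator of a grid with spectral parameters `z`, left spins `+` and right spins
`d`. Its value at `F` and `T` is the partition function with top spins `T`, in which the bottom
spins are weighted by `F`. -/
def gridOperator (z : Fin r → K) (d : Fin r → Fin r) : Module.End K ((Fin n → Fin r → ℕ) → K) :=
  (List.ofFn fun i => rowOperator κ t (z i) (d i)).prod

theorem exists_prod_ofFn_eq_mul_lo_hi_mul {X : Type*} [Monoid X] (g : Fin r → X)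
    (i : Fin (r - 1)) : ∃ x y, ∀ g' : Fin r → X, (∀ k, k ≠ lo i → k ≠ hi i → g' k = g k) →
      (List.ofFn g').prod = x * (g' (lo i) * g' (hi i)) * y := by
  refine ⟨((List.ofFn g).take i).prod, ((List.ofFn g).drop (i + 2)).prod, fun g' hg' => ?_⟩
  have lt : (i : ℕ) + 1 < (List.ofFn g').length := by rw [List.length_ofFn]; omega
  have take_eq : (List.ofFn g').take i = (List.ofFn g).take i := by
    refine List.ext_getElem (by simp) fun k hk _ => ?_
    simp only [List.length_take, lt_inf_iff] at hk
    simpa using hg' _ (Fin.ne_of_val_ne hk.1.ne) (Fin.ne_of_val_ne (hk.1.trans (by simp [hi])).ne)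
  have drop_eq : (List.ofFn g').drop (i + 2) = (List.ofFn g).drop (i + 2) := by
    refine List.ext_getElem (by simp) fun k _ _ => ?_
    simpa using hg' _ (Fin.ne_of_val_ne (by simp only [lo]; omega))
      (Fin.ne_of_val_ne (by simp only [hi]; omega))
  rw [← List.prod_take_mul_prod_drop (List.ofFn g') i, List.drop_eq_getElem_cons (by omega),
    List.drop_eq_getElem_cons lt, take_eq, drop_eq, List.prod_cons, List.prod_cons]
  simp only [List.getElem_ofFn, mul_assoc]
  rfl

theorem gridOperator_exchange (z : Fin r → K) (d : Fin r → Fin r) (i : Fin (r - 1))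
    (hd : d (lo i) < d (hi i)) :
    (z (lo i) - z (hi i)) • gridOperator (n := n) κ t z (d ∘ simpleRefl i) =
      ((1 - t) * z (hi i)) • gridOperator κ t z d +
        (t * z (lo i) - z (hi i)) • gridOperator κ t (z ∘ simpleRefl i) d := by
  obtain ⟨P, Q, split⟩ :=
    exists_prod_ofFn_eq_mul_lo_hi_mul (fun j => rowOperator (n := n) κ t (z j) (d j)) i
  have fixed (k : Fin r) (h : k ≠ lo i) (h' : k ≠ hi i) : simpleRefl i k = k :=
    Equiv.swap_apply_of_ne_of_ne h h'
  rw [gridOperator, gridOperator, gridOperator,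
    split (fun j => rowOperator κ t (z j) ((d ∘ simpleRefl i) j))
      fun k h h' => by simp only [Function.comp_apply, fixed k h h'],
    split (fun j => rowOperator κ t (z j) (d j)) fun _ _ _ => rfl,
    split (fun j => rowOperator κ t ((z ∘ simpleRefl i) j) (d j))
      fun k h h' => by simp only [Function.comp_apply, fixed k h h']]
  have conj_smul (x : K) (X : Module.End K _) : x • (P * X * Q) = P * (x • X) * Q := by
    rw [mul_smul_comm, smul_mul_assoc]
  simp only [Function.comp_apply, simpleRefl_lo, simpleRefl_hi, conj_smul]
  rw [rowOperator_exchange κ t _ _ hd, mul_add, add_mul]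

end RowOperators

/-! ### Sums over states -/

section VerticalConfigs

variable {r n : ℕ}

/-- The configurations of vertical spins in which the multiplicities above row `j` exceed those of
the top spins `T` by at most `j`. Every state of nonzero weight is of this kind. -/
def verticalConfigs (T : Fin n → Fin r → ℕ) : Finset (Fin (r + 1) → Fin n → Fin r → ℕ) :=
  Fintype.piFinset fun j => Finset.Iic (T + (j : ℕ))

theorem prod_ofFn_apply {K X : Type*} [CommSemiring K] {N : ℕ} {A : Fin N → Module.End K (X → K)}
    {m : Fin N → X → X → K} {D : Fin (N + 1) → Finset X} [DecidableEq X]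
    (hA : ∀ i, ∀ T ∈ D i.castSucc, ∀ F, A i F T = ∑ V ∈ D i.succ, m i T V * F V) (F : X → K)
    {T : X} (hT : T ∈ D 0) : (List.ofFn A).prod F T = ∑ v ∈ Fintype.piFinset D,
      if v 0 = T then (∏ i, m i (v i.castSucc) (v i.succ)) * F (v (Fin.last N)) else 0 := by
  induction N generalizing T with
  | zero =>
    rw [Finset.sum_eq_single fun _ => T]
    · simp
    · exact fun v _ hv => if_neg fun h => hv (funext fun j => by rw [Fin.fin_one_eq_zero j, h])
    · exact fun h => absurd (Fintype.mem_piFinset.2 fun j => by rwa [Fin.fin_one_eq_zero j]) h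
  | succ N ih =>
    have tail_sum {V : X} (hV : V ∈ D (Fin.succ 0)) :=
      ih (A := fun i => A i.succ) (m := fun i => m i.succ) (D := fun j => D j.succ)
        (fun i => hA i.succ) hV
    have reindex : Fintype.piFinset D =
        (D 0 ×ˢ Fintype.piFinset (Fin.tail D)).map (Fin.consEquiv fun _ => X).toEmbedding := by
      simpa using Finset.filter_piFinset_eq_map_consEquiv D fun _ => True
    rw [List.ofFn_succ, List.prod_cons, Module.End.mul_apply, hA 0 T hT,
      Finset.sum_congr rfl fun V hV => by rw [tail_sum hV, Finset.mul_sum], Finset.sum_comm,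
      reindex, Finset.sum_map, Finset.sum_product_right]
    refine Finset.sum_congr rfl fun v hv => ?_
    have hv0 : v 0 ∈ D 1 := Fintype.mem_piFinset.1 hv 0
    simp [Fin.prod_univ_succ, hT, hv0, mul_assoc, ← Fin.succ_last]

end VerticalConfigs

section States

variable {K : Type*} [CommRing K] {L : Type*} [CommRing L] {r n : ℕ}

theorem map_monoWeight (φ : K →+* L) (κ : WeightKind) (t z : K) (c : Fin r) (a : Option (Fin r))
    (n : ℕ) (b : Option (Fin r)) (m : ℕ) :
    φ (monoWeight κ t z c a n b m) = monoWeight κ (φ t) (φ z) c a n b m := by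
  rcases a with _ | a <;> rcases b with _ | b <;> cases κ <;> simp only [monoWeight] <;>
    split_ifs <;> simp

theorem map_fusedWeight (φ : K →+* L) (κ : WeightKind) (t z : K) (a : Option (Fin r))
    (T : Fin r → ℕ) (b : Option (Fin r)) (V : Fin r → ℕ) :
    φ (fusedWeight κ t z a T b V) = fusedWeight κ (φ t) (φ z) a T b V := by
  simp only [fusedWeight, map_sum, apply_ite φ, map_prod, map_monoWeight, map_zero]

variable {μ : Fin r → ℤ} {c d : Fin r → Fin r} {M : ℤ}

theorem State.map_weight (φ : K →+* L) (κ : WeightKind) (t : K) (z : Fin r → K)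
    (s : State μ c d M n) : φ (s.weight κ t z) = s.weight κ (φ t) (φ ∘ z) := by
  simp only [weight, map_prod, map_fusedWeight, Function.comp_apply]

theorem State.ver_le {κ : WeightKind} {t : K} {z : Fin r → K} {s : State μ c d M n}
    (h : s.weight κ t z ≠ 0) (j : Fin (r + 1)) : s.ver j ≤ s.ver 0 + (j : ℕ) := by
  induction j using Fin.induction with
  | zero => simp
  | succ j ih =>
    have step : s.ver j.succ ≤ s.ver j.castSucc + 1 := by
      by_contra hlt
      obtain ⟨p, hp⟩ := not_forall.1 hlt
      have vertex_eq_zero := congrFun₂ (fusedMatrix_eq_zero κ t (z j) hp)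
      exact h (Finset.prod_eq_zero (Finset.mem_univ j)
        (Finset.prod_eq_zero (Finset.mem_univ p) (vertex_eq_zero _ _)))
    refine step.trans ((add_le_add_left ih 1).trans_eq ?_)
    rw [add_assoc, Fin.val_succ, Nat.cast_succ, Fin.val_castSucc]

/-- The horizontal and vertical spins of a state, without its boundary conditions. -/
def State.spins (s : State μ c d M n) :
    (Fin r → Fin (n + 1) → Option (Fin r)) × (Fin (r + 1) → Fin n → Fin r → ℕ) :=
  (s.hor, s.ver)

theorem State.spins_injective : Function.Injective (State.spins : State μ c d M n → _) :=
  fun _ _ h => State.ext (congrArg Prod.fst h) (congrArg Prod.snd h)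

/-- The top boundary spins of the system with `n` columns, indexed by the positions of the columns
instead of their labels. -/
def topSpins (μ : Fin r → ℤ) (c : Fin r → Fin r) (M : ℤ) (n : ℕ) (p : Fin n) : Fin r → ℕ :=
  topSpin μ c (M + (p.rev : ℤ))

theorem State.ver_mem_verticalConfigs {κ : WeightKind} {t : K} {z : Fin r → K}
    {s : State μ c d M n} (h : s.weight κ t z ≠ 0) :
    s.ver ∈ verticalConfigs (topSpins μ c M n) := by
  refine Fintype.mem_piFinset.2 fun j => Finset.mem_Iic.2 ((s.ver_le h j).trans_eq ?_)
  rw [funext s.ver_top]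
  rfl

theorem State.finite_weight_ne_zero (κ : WeightKind) (t : K) (z : Fin r → K) :
    {s : State μ c d M n | s.weight κ t z ≠ 0}.Finite :=
  ((Finset.univ ×ˢ verticalConfigs (topSpins μ c M n)).finite_toSet.preimage
    State.spins_injective.injOn).subset fun _ hs =>
      Finset.mem_product.2 ⟨Finset.mem_univ _, State.ver_mem_verticalConfigs hs⟩

theorem finsum_weight_eq_sum_verticalConfigs (κ : WeightKind) (t : K) (z : Fin r → K) :
    ∑ᶠ s : State μ c d M n, s.weight κ t z =
      ∑ v ∈ verticalConfigs (topSpins μ c M n),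
        if v 0 = topSpins μ c M n ∧ v (Fin.last r) = 0 then
          ∏ i, rowMatrix κ t (z i) (v i.castSucc) (v i.succ) none (some (d i))
        else 0 := by
  have expand (v : Fin (r + 1) → Fin n → Fin r → ℕ) :
      (if v 0 = topSpins μ c M n ∧ v (Fin.last r) = 0 then
        ∏ i, rowMatrix κ t (z i) (v i.castSucc) (v i.succ) none (some (d i)) else 0) =
        ∑ g : Fin r → Fin (n + 1) → Option (Fin r),
          if (v 0 = topSpins μ c M n ∧ v (Fin.last r) = 0) ∧
              ∀ i, g i 0 = none ∧ g i (Fin.last n) = some (d i) then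
            ∏ i, ∏ p, fusedWeight κ t (z i) (g i p.castSucc) (v i.castSucc p) (g i p.succ)
              (v i.succ p) else 0 := by
    simp only [rowMatrix, pathSum, fusedMatrix, Matrix.of_apply, Finset.prod_univ_sum,
      Fintype.piFinset_univ, Finset.prod_ite_zero, Finset.mem_univ, true_imp_iff]
    split_ifs with h <;> simp [h]
  have finite := State.finite_weight_ne_zero (μ := μ) (c := c) (d := d) (M := M) (n := n) κ t z
  rw [finsum_eq_sum_of_support_subset (s := finite.toFinset) _ (by simp [Function.support])]
  simp only [expand]
  rw [← Finset.sum_product_right']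
  refine Finset.sum_of_injOn State.spins State.spins_injective.injOn ?_ ?_ ?_
  · exact fun s hs => Finset.mem_coe.2 (Finset.mem_product.2
      ⟨Finset.mem_univ _, State.ver_mem_verticalConfigs (by simpa using hs)⟩)
  · rintro ⟨hor, ver⟩ _ not_state
    refine ite_eq_right_iff.2 fun ⟨⟨top, bottom⟩, sides⟩ => ?_
    by_contra weight_ne_zero
    exact not_state ⟨⟨hor, ver, fun i => (sides i).1, fun i => (sides i).2, congrFun top,
      congrFun bottom⟩, by simpa [State.weight] using weight_ne_zero, rfl⟩
  · intro s _
    exact (if_pos ⟨⟨funext s.ver_top, funext s.ver_bottom⟩,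
      fun i => ⟨s.hor_left i, s.hor_right i⟩⟩).symm

variable (κ : WeightKind) (t : K)

theorem gridOperator_apply (z : Fin r → K) (d : Fin r → Fin r) (F : (Fin n → Fin r → ℕ) → K)
    (T : Fin n → Fin r → ℕ) : gridOperator κ t z d F T = ∑ v ∈ verticalConfigs T,
      if v 0 = T then
        (∏ i, rowMatrix κ t (z i) (v i.castSucc) (v i.succ) none (some (d i))) *
          F (v (Fin.last r))
      else 0 := by
  refine prod_ofFn_apply (D := fun j => Finset.Iic (T + (j : ℕ)))
    (fun i V hV G => rowOperator_apply_of_le κ t (z i) (d i) G ?_) F (Finset.mem_Iic.2 (by simp))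
  refine (add_le_add_left (Finset.mem_Iic.1 hV) 1).trans_eq ?_
  rw [add_assoc, Fin.val_succ, Nat.cast_succ, Fin.val_castSucc]

theorem finsum_weight_eq_gridOperator (z : Fin r → K) :
    ∑ᶠ s : State μ c d M n, s.weight κ t z =
      gridOperator κ t z d (Pi.single 0 1) (topSpins μ c M n) := by
  rw [finsum_weight_eq_sum_verticalConfigs, gridOperator_apply]
  refine Finset.sum_congr rfl fun v _ => ?_
  simp only [Pi.single_apply, mul_ite, mul_one, mul_zero, ite_and]

end States

/-! ### The frozen state -/

section FrozenVertex

variable {K : Type*} [CommRing K] {r : ℕ} (κ : WeightKind) (t z : K) (T V : Fin r → ℕ)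

theorem prod_delta_mul (x : Fin r → K) :
    ∏ c, delta (T c) (V c) * x c = if T = V then ∏ c, x c else 0 := by
  simp only [delta, ite_mul, one_mul, zero_mul, Finset.prod_ite_zero, Finset.mem_univ, true_imp_iff,
    funext_iff]

theorem prod_pass (d : Fin r) (x : K) :
    ∏ c, (if c = d then x else pass t c d (T c)) = x * t ^ ∑ c ∈ Finset.Iio d, T c := by
  rw [← Finset.mul_prod_erase _ _ (Finset.mem_univ d), if_pos rfl, ← Finset.prod_pow_eq_pow_sum]
  congr 1
  symm
  refine Finset.prod_subset_one_on_sdiff (fun c hc => ?_) (fun c hc => ?_) fun c hc => ?_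
  · exact Finset.mem_erase.2 ⟨(Finset.mem_Iio.1 hc).ne, Finset.mem_univ c⟩
  · simp only [Finset.mem_sdiff, Finset.mem_erase, Finset.mem_univ, Finset.mem_Iio, not_lt,
      and_true] at hc
    rw [if_neg hc.1, pass, if_pos (hc.2.lt_of_ne' hc.1)]
  · have hcd := Finset.mem_Iio.1 hc
    rw [if_neg hcd.ne, pass, if_neg hcd.not_gt]

/-- The colors of the monochrome vertices to the left of the edge `k` inside a fused vertex. -/
def passedColors (k : Fin (r + 1)) : Finset (Fin r) := {c | c.rev.castSucc < k}

theorem passedColors_succ (k : Fin r) :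
    passedColors k.succ = insert k.rev (passedColors k.castSucc) := by
  ext c
  simp only [passedColors, Finset.mem_filter_univ, Finset.mem_insert, Fin.castSucc_lt_succ_iff,
    Fin.castSucc_lt_castSucc_iff, le_iff_eq_or_lt, Fin.rev_eq_iff]

theorem passedColors_last : passedColors (Fin.last r) = Finset.univ := by
  simp [passedColors, Fin.castSucc_lt_last]

theorem rev_notMem_passedColors (k : Fin r) : k.rev ∉ passedColors k.castSucc := by
  simp [passedColors]

/-- The weights of the horizontal spins at the edge `k` inside a fused vertex with left spin `+`. -/
def vacuumWeight (k : Fin (r + 1)) : Option (Fin r) → K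
  | none => ∏ c ∈ passedColors k, delta (T c) (V c)
  | some d => if d ∈ passedColors k then
      ∏ c ∈ passedColors k, delta (T c) ((V + Pi.single d 1 : Fin r → ℕ) c) *
        (if c = d then absorb κ t (V d) else pass t c d (T c)) else 0

theorem vacuumWeight_vecMul (k : Fin r) :
    vacuumWeight κ t T V k.castSucc ᵥ* monoMatrix κ t z k.rev (T k.rev) (V k.rev) =
      vacuumWeight κ t T V k.succ := by
  have notMem := rev_notMem_passedColors k
  ext (_ | d)
  · rw [vecMul_monoMatrix_none]
    simp only [vacuumWeight, passedColors_succ, Finset.prod_insert notMem, if_neg notMem,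
      mul_zero, add_zero, delta_comm]
  rcases eq_or_ne d k.rev with rfl | hd
  · rw [vecMul_monoMatrix_self]
    have prod_passed : ∏ c ∈ passedColors k.castSucc,
        (delta (T c) ((V + Pi.single k.rev 1 : Fin r → ℕ) c) : K) *
          (if c = k.rev then absorb κ t (V k.rev) else pass t c k.rev (T c)) =
        ∏ c ∈ passedColors k.castSucc, delta (T c) (V c) := by
      refine Finset.prod_congr rfl fun c hc => ?_
      have lt : k.rev < c := by simpa [passedColors, Fin.rev_lt_iff] using hc
      simp [lt.ne', pass, lt]
    simp only [vacuumWeight, passedColors_succ, Finset.prod_insert notMem, if_neg notMem,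
      Finset.mem_insert_self, if_true, prod_passed]
    simp only [Pi.add_apply, Pi.single_eq_same, mul_zero, add_zero, mul_assoc]
  · rw [vecMul_monoMatrix_of_ne κ t z _ _ _ _ hd]
    simp only [vacuumWeight, passedColors_succ, Finset.prod_insert notMem, Finset.mem_insert, hd,
      false_or, mul_ite, mul_zero]
    simp [hd.symm, delta_comm, mul_assoc]

theorem fusedMatrix_none : fusedMatrix κ t z T V none = vacuumWeight κ t T V (Fin.last r) := by
  have start : vacuumWeight κ t T V 0 = Pi.single none 1 := by
    ext (_ | d) <;> simp [vacuumWeight, passedColors]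
  rw [fusedMatrix_eq_pathSum, ← vecMul_pathSum_of_step (vacuumWeight_vecMul κ t z T V), start,
    Matrix.single_one_vecMul]
  rfl

theorem fusedMatrix_none_none : fusedMatrix κ t z T V none none = if T = V then 1 else 0 := by
  rw [fusedMatrix_none, vacuumWeight]
  simpa [passedColors_last] using prod_delta_mul (K := K) T V 1

theorem fusedMatrix_none_some (d : Fin r) : fusedMatrix κ t z T V none (some d) =
    if T = V + Pi.single d 1 then absorb κ t (V d) * t ^ ∑ c ∈ Finset.Iio d, T c else 0 := by
  simp only [fusedMatrix_none, vacuumWeight, passedColors_last, Finset.mem_univ, if_true,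
    prod_delta_mul, prod_pass]

theorem fusedMatrix_zero_none (x : Option (Fin r)) : fusedMatrix κ t z 0 V none x =
    if x = none then if 0 = V then 1 else 0 else 0 := by
  cases x with
  | none => rw [fusedMatrix_none_none, if_pos rfl]
  | some d =>
    rw [fusedMatrix_none_some, if_neg (Option.some_ne_none d), if_neg]
    exact fun h => by simpa using congrFun h d

theorem fusedMatrix_apply_some_of_eq_zero {d : Fin r} (hd : T d = 0) (x : Option (Fin r)) :
    fusedMatrix κ t z T V x (some d) =
      if x = some d then if T = V then z * t ^ ∑ c ∈ Finset.Iio d, T c else 0 else 0 := by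
  rw [fusedMatrix_eq_pathSum, pathSum_apply_of_col (w := fun k => delta (T k.rev) (V k.rev) *
    if k.rev = d then z else pass t k.rev d (T k.rev))]
  · rw [← prod_pass, ← prod_delta_mul, ← Equiv.prod_comp Fin.revPerm]
    simp only [Fin.revPerm_apply, Fin.rev_rev]
  · intro k x
    rcases eq_or_ne d k.rev with rfl | h
    · rcases x with _ | e
      · simp [monoMatrix_none_some, hd, delta_zero_succ]
      · rcases eq_or_ne e k.rev with rfl | he
        · simp [monoMatrix_some_some, delta_comm]
        · simp [monoMatrix_some_some, he]
    · rw [monoMatrix_apply_some_of_ne κ t z _ _ _ h, if_neg h.symm, delta_comm]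

end FrozenVertex

section FrozenRow

variable {K : Type*} [CommRing K] {n r : ℕ} (κ : WeightKind) (t z : K)

theorem rowMatrix_apply_of_leftmost {T : Fin n → Fin r → ℕ} {p₀ : Fin n} {d : Fin r}
    (left : ∀ p < p₀, T p = 0) (absent : ∀ p, T p d = 0) (V : Fin n → Fin r → ℕ) :
    rowMatrix κ t z (T + Pi.single p₀ (Pi.single d 1)) V none (some d) =
      if T = V then z ^ (p₀.rev : ℕ) * t ^ ∑ p, ∑ c ∈ Finset.Iio d, T p c else 0 := by
  set S : Fin n → Fin r → ℕ := Pi.single p₀ (Pi.single d 1)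
  have passed_eq (p : Fin n) :
      ∑ c ∈ Finset.Iio d, (T + S) p c = ∑ c ∈ Finset.Iio d, T p c := by
    refine Finset.sum_congr rfl fun c hc => ?_
    rcases eq_or_ne p p₀ with rfl | hp
    · simp [S, (Finset.mem_Iio.1 hc).ne]
    · simp [S, hp]
  rw [rowMatrix, pathSum_apply_of_jump (w := fun p => if T p = V p then
    (if p₀ < p then z else 1) * t ^ ∑ c ∈ Finset.Iio d, T p c else 0) p₀]
  · simp only [Finset.prod_ite_zero, Finset.mem_univ, forall_const, ← funext_iff,
      Finset.prod_mul_distrib, Finset.prod_pow_eq_pow_sum]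
    rw [← Finset.prod_filter, Finset.prod_const, Finset.filter_lt_eq_Ioi, Fin.card_Ioi,
      Fin.val_rev, Nat.sub_sub, add_comm 1]
  · intro p hp x
    have hS : (T + S) p = 0 := by simp [S, hp.ne, left p hp]
    rw [hS, fusedMatrix_zero_none, left p hp]
    simp [hp.not_gt]
  · have hS : (T + S) p₀ = T p₀ + Pi.single d 1 := by simp [S]
    rw [fusedMatrix_none_some, passed_eq, hS, if_neg (lt_irrefl p₀)]
    refine ite_congr (by rw [add_left_inj]) (fun h => ?_) fun _ => rfl
    rw [← h, absent, absorb_zero]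
  · intro p hp x
    have hS : (T + S) p = T p := by simp [S, hp.ne']
    rw [hS, fusedMatrix_apply_some_of_eq_zero κ t z _ _ (absent p), if_pos hp]

theorem rowOperator_apply_of_leftmost {T : Fin n → Fin r → ℕ} {p₀ : Fin n} {d : Fin r}
    (left : ∀ p < p₀, T p = 0) (absent : ∀ p, T p d = 0) (F : (Fin n → Fin r → ℕ) → K) :
    rowOperator κ t z d F (T + Pi.single p₀ (Pi.single d 1)) =
      z ^ (p₀.rev : ℕ) * t ^ (∑ p, ∑ c ∈ Finset.Iio d, T p c) * F T := by
  simp only [rowOperator, LinearMap.coe_mk, AddHom.coe_mk,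
    rowMatrix_apply_of_leftmost κ t z left absent, ite_mul, zero_mul, Finset.sum_ite_eq]
  rw [if_pos (Finset.mem_Iic.2 (le_add_right (le_add_right le_rfl)))]

end FrozenRow

section FrozenGrid

variable {K : Type*} [CommRing K] {n r : ℕ} (κ : WeightKind) (t : K)

theorem prod_ofFn_apply_of_transport {X : Type*} {N : ℕ} {A : Fin N → Module.End K (X → K)}
    {w : Fin N → K} {x : Fin (N + 1) → X}
    (hA : ∀ k F, A k F (x k.castSucc) = w k * F (x k.succ)) (F : X → K) :
    (List.ofFn A).prod F (x 0) = (∏ k, w k) * F (x (Fin.last N)) := by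
  induction N with
  | zero => simp
  | succ N ih =>
    rw [List.ofFn_succ, List.prod_cons, Module.End.mul_apply, ← Fin.castSucc_zero' (n := N + 1), hA,
      Fin.prod_univ_succ, mul_assoc]
    exact congrArg _ (ih (x := fun k => x k.succ) fun k => hA k.succ)

/-- The vertical spins above row `i` in the frozen state: row `j` carries a particle of color `c j`
from the column in position `pos j` to the right. -/
def frozenSpins (pos : Fin r → Fin n) (c : Fin r → Fin r) (i : Fin (r + 1)) : Fin n → Fin r → ℕ :=
  ∑ j with i ≤ j.castSucc, Pi.single (pos j) (Pi.single (c j) 1)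

variable {pos : Fin r → Fin n} {c : Fin r → Fin r}

theorem frozenSpins_castSucc (i : Fin r) : frozenSpins pos c i.castSucc =
    frozenSpins pos c i.succ + Pi.single (pos i) (Pi.single (c i) 1) := by
  have split : Finset.univ.filter (fun j : Fin r => i.castSucc ≤ j.castSucc) =
      insert i (Finset.univ.filter fun j : Fin r => i.succ ≤ j.castSucc) := by
    ext j
    rw [Finset.mem_filter_univ, Finset.mem_insert, Finset.mem_filter_univ,
      Fin.castSucc_le_castSucc_iff, Fin.succ_le_castSucc_iff, le_iff_eq_or_lt, eq_comm]
  rw [frozenSpins, split, Finset.sum_insert (by simp), add_comm, frozenSpins]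

theorem frozenSpins_apply (i : Fin (r + 1)) (p : Fin n) (k : Fin r) : frozenSpins pos c i p k =
    (Finset.univ.filter fun j : Fin r => i ≤ j.castSucc ∧ pos j = p ∧ c j = k).card := by
  simp only [frozenSpins, Finset.sum_apply, Pi.single_apply, Finset.sum_filter, Finset.card_filter]
  refine Finset.sum_congr rfl fun j _ => ?_
  rcases eq_or_ne p (pos j) with rfl | hp
  · simp [Pi.single_apply, ite_and, eq_comm]
  · simp [hp, hp.symm]

theorem frozenSpins_last : frozenSpins pos c (Fin.last r) = 0 := by
  simp [frozenSpins]

theorem sum_frozenSpins_succ (i : Fin r) :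
    ∑ p, ∑ k ∈ Finset.Iio (c i), frozenSpins pos c i.succ p k =
      (Finset.univ.filter fun j => i < j ∧ c j < c i).card := by
  simp only [frozenSpins_apply]
  have fiberwise := Finset.sum_card_fiberwise_eq_card_filter (Finset.univ.filter fun j => i < j)
    (Finset.univ ×ˢ Finset.Iio (c i)) fun j => (pos j, c j)
  simpa only [Finset.sum_product, Finset.filter_filter, Prod.mk.injEq, Finset.mem_product,
    Finset.mem_univ, true_and, Finset.mem_Iio, frozenSpins_apply, Fin.succ_le_castSucc_iff]
    using fiberwise

theorem gridOperator_frozenSpins (z : Fin r → K) (hpos : Monotone pos)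
    (hc : Function.Injective c) :
    gridOperator κ t z c (Pi.single 0 1) (frozenSpins pos c 0) =
      (∏ i, z i ^ ((pos i).rev : ℕ)) *
        t ^ (Finset.univ.filter fun p : Fin r × Fin r => p.1 < p.2 ∧ c p.2 < c p.1).card := by
  have exponent : ∑ i, ∑ p, ∑ k ∈ Finset.Iio (c i), frozenSpins pos c i.succ p k =
      (Finset.univ.filter fun p : Fin r × Fin r => p.1 < p.2 ∧ c p.2 < c p.1).card := by
    simp only [sum_frozenSpins_succ, Finset.card_filter, Fintype.sum_prod_type]
  have transport (i : Fin r) (F : (Fin n → Fin r → ℕ) → K) :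
      rowOperator κ t (z i) (c i) F (frozenSpins pos c i.castSucc) =
        z i ^ ((pos i).rev : ℕ) *
          t ^ (∑ p, ∑ k ∈ Finset.Iio (c i), frozenSpins pos c i.succ p k) *
            F (frozenSpins pos c i.succ) := by
    rw [frozenSpins_castSucc]
    refine rowOperator_apply_of_leftmost κ t (z i) ?_ ?_ F
    · intro p hp
      ext k
      rw [frozenSpins_apply, Pi.zero_apply, Finset.card_eq_zero,
        Finset.filter_eq_empty_iff]
      rintro j - ⟨hij, rfl, -⟩
      exact hp.not_ge (hpos (Fin.succ_le_castSucc_iff.1 hij).le)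
    · intro p
      rw [frozenSpins_apply, Finset.card_eq_zero, Finset.filter_eq_empty_iff]
      rintro j - ⟨hij, -, hj⟩
      exact (Fin.succ_le_castSucc_iff.1 hij).ne' (hc hj)
  rw [gridOperator, prod_ofFn_apply_of_transport transport, frozenSpins_last, Pi.single_eq_same,
    mul_one, Finset.prod_mul_distrib, Finset.prod_pow_eq_pow_sum, exponent]

end FrozenGrid

/-! ### Partition functions -/

section PartitionFunction

variable {R : Type*} [CommRing R] [IsDomain R] {r n : ℕ} (κ : WeightKind) (t : Rˣ)

section Recursion

variable (μ : Fin r → ℤ) (c d : Fin r → Fin r) (M : ℤ)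

theorem partitionFunction_eq_gridOperator :
    partitionFunction κ t μ c d M n = (∏ i, zvar R i) ^ M *
      gridOperator κ (param r t) (zvar R) d (Pi.single 0 1) (topSpins μ c M n) := by
  rw [partitionFunction, finsum_weight_eq_gridOperator]

theorem permVars_partitionFunction (σ : Equiv.Perm (Fin r)) :
    permVars R σ (partitionFunction κ t μ c d M n) = (∏ i, zvar R i) ^ M *
      gridOperator κ (param r t) (zvar R ∘ σ) d (Pi.single 0 1) (topSpins μ c M n) := by
  have permVars_weight (s : State μ c d M n) :
      permVars R σ (s.weight κ (param r t) (zvar R)) = s.weight κ (param r t) (zvar R ∘ σ) := by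
    have h := s.map_weight (permVars R σ : RatField R r →+* RatField R r) κ (param r t) (zvar R)
    simpa only [RingHom.coe_coe, permVars_param, Function.comp_def, permVars_zvar] using h
  have permVars_finsum := (permVars R σ).toAddEquiv.map_finsum
    fun s : State μ c d M n => s.weight κ (param r t) (zvar R)
  simp only [RingEquiv.toAddEquiv_eq_coe, RingEquiv.coe_toAddEquiv, permVars_weight]
    at permVars_finsum
  rw [partitionFunction, map_mul, map_zpow₀, map_prod, permVars_finsum,
    finsum_weight_eq_gridOperator]
  simp only [permVars_zvar, Equiv.prod_comp σ (zvar R)]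

theorem zvar_mem_laurent (i : Fin r) : zvar R i ∈ laurent R r :=
  Algebra.subset_adjoin (Or.inl ⟨i, rfl⟩)

theorem zvar_zpow_mem_laurent (i : Fin r) : zvar R i ^ M ∈ laurent R r := by
  cases M with
  | ofNat m =>
    rw [Int.ofNat_eq_natCast, zpow_natCast]
    exact pow_mem (zvar_mem_laurent i) m
  | negSucc m =>
    have inv_mem : (zvar R i)⁻¹ ∈ laurent R r := Algebra.subset_adjoin (Or.inr ⟨i, rfl⟩)
    rw [zpow_negSucc, ← inv_pow]
    exact pow_mem inv_mem _

theorem partitionFunction_mem_laurent : partitionFunction κ t μ c d M n ∈ laurent R r := by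
  have weight_mem (s : State μ c d M n) : s.weight κ (param r t) (zvar R) ∈ laurent R r := by
    have h := s.map_weight (laurent R r).val.toRingHom κ
      ⟨param r t, Subalgebra.algebraMap_mem _ _⟩ fun i => ⟨zvar R i, zvar_mem_laurent i⟩
    exact h ▸ Subtype.property _
  rw [partitionFunction, ← Finset.prod_zpow]
  exact mul_mem (prod_mem fun i _ => zvar_zpow_mem_laurent M i)
    (finsum_induction (· ∈ laurent R r) (zero_mem _) (fun _ _ => add_mem) weight_mem)

variable {w : Equiv.Perm (Fin r)} {i : Fin (r - 1)}

theorem partitionFunction_up (h : len w < len (simpleRefl i * w)) :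
    partitionFunction κ t μ c (flag (simpleRefl i * w)) M n =
      demLus t i (partitionFunction κ t μ c (flag w) M n) := by
  have flag_mul : flag (simpleRefl i * w) = flag w ∘ simpleRefl i :=
    funext (inv_simpleRefl_mul_apply i w)
  have exchange := congrFun (LinearMap.congr_fun
    (gridOperator_exchange κ (param r t) (zvar R) (flag w) i (len_lt_len_simpleRefl_mul_iff.1 h))
    (Pi.single 0 1)) (topSpins μ c M n)
  apply eq_demLus_of_exchange
  rw [permVars_partitionFunction]
  simp only [partitionFunction_eq_gridOperator, flag_mul]
  simp only [LinearMap.smul_apply, LinearMap.add_apply, Pi.smul_apply, Pi.add_apply, smul_eq_mul]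
    at exchange
  linear_combination (∏ i, zvar R i) ^ M * exchange

theorem partitionFunction_down (h : len (simpleRefl i * w) < len w) :
    partitionFunction κ t μ c (flag (simpleRefl i * w)) M n =
      demLusInv t i (partitionFunction κ t μ c (flag w) M n) := by
  have up := partitionFunction_up (n := n) κ t μ c M (w := simpleRefl i * w) (i := i)
    (by rwa [simpleRefl_mul_cancel])
  rw [simpleRefl_mul_cancel] at up
  rw [up, demLusInv_demLus]

end Recursion

variable {μ : Fin r → ℤ} {M : ℤ}

theorem exists_topSpins_eq_frozenSpins (hμ : Antitone μ) (hM : ∀ i, M ≤ μ i)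
    (hn : ∀ i, μ i < M + n) (c : Fin r → Fin r) :
    ∃ pos : Fin r → Fin n, Monotone pos ∧ (∀ j, M + ((pos j).rev : ℕ) = μ j) ∧
      topSpins μ c M n = frozenSpins pos c 0 := by
  have label_bound (j : Fin r) : (μ j - M).toNat < n := by grind
  let pos (j : Fin r) : Fin n := Fin.rev ⟨(μ j - M).toNat, label_bound j⟩
  have label_pos (j : Fin r) : M + ((pos j).rev : ℕ) = μ j := by grind
  refine ⟨pos, fun i j hij => ?_, label_pos, ?_⟩
  · exact Fin.rev_le_rev.2 (Int.toNat_le_toNat (sub_le_sub_right (hμ hij) M))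
  · ext p k
    have label_eq_iff (j : Fin r) : μ j = M + (p.rev : ℤ) ↔ pos j = p := by
      rw [← label_pos j, add_right_inj, Nat.cast_inj, Fin.val_inj, Fin.rev_inj]
    simp only [topSpins, topSpin, frozenSpins_apply, label_eq_iff, Fin.zero_le, true_and]

theorem partitionFunction_base (hμ : Antitone μ) (hM : ∀ i, M ≤ μ i) (hn : ∀ i, μ i < M + n)
    (y : Equiv.Perm (Fin r)) :
    partitionFunction κ t μ (flag y) (flag y) M n = param r t ^ len y * zmon R μ := by
  obtain ⟨pos, monotone_pos, label_pos, top⟩ := exists_topSpins_eq_frozenSpins hμ hM hn (flag y)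
  rw [partitionFunction_eq_gridOperator, top,
    gridOperator_frozenSpins (c := flag y) κ _ _ monotone_pos y⁻¹.injective, ← len_inv y,
    ← mul_assoc, mul_comm, ← Finset.prod_zpow, ← Finset.prod_mul_distrib]
  refine congrArg _ (Finset.prod_congr rfl fun i _ => ?_)
  rw [← zpow_natCast, ← zpow_add₀ (zvar_ne_zero i), label_pos]

theorem partitionFunction_eq_demLusWord (hμ : Antitone μ) (hM : ∀ i, M ≤ μ i)
    (hn : ∀ i, μ i < M + n) {w : Equiv.Perm (Fin r)} {l : List (Fin (r - 1))}
    (h : IsReducedWord w l) :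
    partitionFunction κ t μ (flag 1) (flag w) M n = demLusWord t l (zmon R μ) := by
  induction l generalizing w with
  | nil =>
    obtain rfl : w = 1 := by simpa using h.1.symm
    rw [partitionFunction_base κ t hμ hM hn, len_one, pow_zero, one_mul, demLusWord]
  | cons i l ih =>
    have up := partitionFunction_up (n := n) κ t μ (flag 1) M (w := simpleRefl i * w) (i := i)
      (by rw [simpleRefl_mul_cancel]; exact h.tail.2)
    rwa [simpleRefl_mul_cancel, ih h.tail.1] at up

theorem isTauFamily_partitionFunction (hμ : Antitone μ) (hM : ∀ i, M ≤ μ i)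
    (hn : ∀ i, μ i < M + n) (y : Equiv.Perm (Fin r)) :
    IsTauFamily t μ y fun w => partitionFunction (R := R) κ t μ (flag y) (flag w) M n where
  mem_laurent _ := partitionFunction_mem_laurent κ t μ _ _ M
  base := partitionFunction_base κ t hμ hM hn y
  up _ _ h := partitionFunction_up κ t μ _ M h
  down _ _ h := partitionFunction_down κ t μ _ M h

end PartitionFunction

theorem IsTauFamily.unique {R : Type*} [CommRing R] [IsDomain R] {r : ℕ} {t : Rˣ} {μ : Fin r → ℤ}
    {y : Equiv.Perm (Fin r)} {τ τ' : Equiv.Perm (Fin r) → RatField R r}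
    (h : IsTauFamily t μ y τ) (h' : IsTauFamily t μ y τ') : τ' = τ := by
  have eq_of_word (l : List (Fin (r - 1))) :
      τ' ((l.map simpleRefl).prod * y) = τ ((l.map simpleRefl).prod * y) := by
    induction l with
    | nil => simp [h.base, h'.base]
    | cons i l ih =>
      rw [List.map_cons, List.prod_cons, mul_assoc]
      generalize (l.map simpleRefl).prod * y = w at ih ⊢
      rcases inv_lo_lt_or_gt i w with hw | hw
      · have longer : len w < len (simpleRefl i * w) := by
          rw [len_simpleRefl_mul_of_lt hw]; omega
        rw [h.up i w longer, h'.up i w longer, ih]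
      · have shorter : len (simpleRefl i * w) < len w := by
          have len_eq := len_simpleRefl_mul_of_gt hw
          omega
        rw [h.down i w shorter, h'.down i w shorter, ih]
  funext w
  obtain ⟨l, hl, -⟩ := exists_isReducedWord (w * y⁻¹)
  simpa only [hl, inv_mul_cancel_right] using eq_of_word l

end ColoredBoson

open ColoredBoson in
theorem mainTheorem6 {R : Type*} [CommRing R] [IsDomain R] (t : Rˣ) (κ : WeightKind) {r : ℕ}
    (μ : Fin r → ℤ) (hμ : Antitone μ) (M : ℤ) (n : ℕ) (hM : ∀ i, M ≤ μ i)
    (hn : ∀ i, μ i < M + n) :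
    -- the sum over the states that defines each partition function is finite
    (∀ y w : Equiv.Perm (Fin r),
      {s : State μ (flag y) (flag w) M n | s.weight κ (param r t) (zvar R) ≠ 0}.Finite) ∧
    -- `Z(𝔖_{μ, 𝐜₀, w𝐜₀}) = 𝓛_{w,t} z^μ`, where `𝓛_{w,t}` is computed from any reduced word of `w`
    (∀ w : Equiv.Perm (Fin r), (∃ l, IsReducedWord w l) ∧ ∀ l, IsReducedWord w l →
      partitionFunction κ t μ (flag 1) (flag w) M n = demLusWord t l (zmon R μ)) ∧
    -- `Z(𝔖_{μ, y𝐜₀, w𝐜₀}) = τ^μ_{w,y}`, where `(τ^μ_{w,y})_w` is the unique family with its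
    -- characterizing properties
    (∀ y : Equiv.Perm (Fin r), ∃ τ : Equiv.Perm (Fin r) → RatField R r,
      IsTauFamily t μ y τ ∧ (∀ τ', IsTauFamily t μ y τ' → τ' = τ) ∧
      ∀ w, partitionFunction κ t μ (flag y) (flag w) M n = τ w) := by
  refine ⟨fun y w => State.finite_weight_ne_zero κ _ _,
    fun w => ⟨exists_isReducedWord w, fun l hl =>
      partitionFunction_eq_demLusWord κ t hμ hM hn hl⟩, fun y => ?_⟩
  have h := isTauFamily_partitionFunction (R := R) κ t hμ hM hn y
  exact ⟨_, h, fun τ' h' => h.unique h', fun w => rfl⟩
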